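/- Work in the dual quaternions $\mathbb{DH}=\{A+\epsilon B : A,B\in\mathbb H\}$, $\epsilon^2=0$, $\epsilon$ central. A closed $5$-linkage with joints of type R (revolute) and P (prismatic) is a tuple $L=(j_1,\dots,j_5)$, with cyclic indexing of the joints; an R-joint $j_k$ is given by its axis, a real dual quaternion $h_k=p_k+\epsilon q_k$ with $h_k^2=-1$, and a P-joint $j_k$ by its direction, a real quaternion $p_k$ with $p_k^2=-1$. The motion of an R-joint with parameter $t_k\in\mathbb P^1_{\mathbb C}=\mathbb C\cup\{\infty\}$ is $m_k=t_k-h_k$ (and $m_k=1$ if $t_k=\infty$); the motion of a P-joint with parameter $s_k\in\mathbb C$ is $m_k=1-\epsilon s_kp_k$. The configuration set $K$ is the set of all (complex) joint parameters for which $m_1m_2m_3m_4m_5$ is a nonzero (complex) scalar. The mobility of $L$ is the dimension of $K$ as a complex analytic set, and $L$ is mobile if its mobility is positive. $L$ is degenerate if two neighbouring R-joints have equal axes ($h_{k+1}=\pm h_k$) or two neighbouring P-joints have equal directions ($p_{k+1}=\pm p_k$). We write $h_k\parallel h_l$ if $p_k=\pm p_l$. A joint is said to move if its parameter is non-constant along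 some holomorphic arc in $K$ (equivalently, on some irreducible component of $K$). **Theorem.** Let $L$ be a mobile, non-degenerate $5$-linkage with at least one P-joint and all other joints of type R, and assume that all five joints move. Then one of the following holds. 1. All axes of R-joints are parallel. 2. Up to a cyclic shift of the indices, $j_1$ is the only P-joint, $h_2\parallel h_3$ and $h_4\parallel h_5$. Moreover, $L$ has mobility $1$, and on all of $K$ one has $t_2=\sigma t_3$ and $t_4=\tau t_5$ with constant signs $\sigma,\tau\in\{1,-1\}$ (where $-\infty=\infty$). -/

import Mathlib

open scoped Quaternion Topology

noncomputable section

/-- The dual quaternions `A + ε B` with `A, B` quaternions over `F`. -/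
abbrev DualQuat (F : Type) [CommRing F] : Type := DualNumber (Quaternion F)

/-- The inclusion of the real quaternions into the complexified quaternions. -/
def complexifyQuat (q : ℍ[ℝ]) : ℍ[ℂ] :=
  ⟨(q.re : ℂ), (q.imI : ℂ), (q.imJ : ℂ), (q.imK : ℂ)⟩

/-- The dual quaternion `a + ε b`. -/
def DualQuat.mk {F : Type} [CommRing F] (a b : Quaternion F) : DualQuat F :=
  TrivSqZeroExt.inl a + TrivSqZeroExt.inr b

@[simp] theorem DualQuat.fst_mk {F : Type} [CommRing F] (a b : Quaternion F) :
    TrivSqZeroExt.fst (DualQuat.mk a b) = a := add_zero a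

@[simp] theorem DualQuat.snd_mk {F : Type} [CommRing F] (a b : Quaternion F) :
    TrivSqZeroExt.snd (DualQuat.mk a b) = b := zero_add b

/-- The inclusion of the real dual quaternions into the complexified dual quaternions. -/
def complexifyDual (h : DualQuat ℝ) : DualQuat ℂ :=
  DualQuat.mk (complexifyQuat h.fst) (complexifyQuat h.snd)

/-- A revolute or prismatic joint with its (real) geometric data: an R-joint is given by its
rotation axis, a dual quaternion `h` with `h² = -1`, and a P-joint by its direction, a quaternion
`p` with `p² = -1`. -/
inductive Joint : Type
  | R (h : DualQuat ℝ) (sq : h * h = -1) : Joint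
  | P (p : ℍ[ℝ]) (sq : p * p = -1) : Joint

namespace Joint

/-- The joint is revolute. -/
def IsR : Joint → Prop
  | R _ _ => True
  | P _ _ => False

/-- The joint is prismatic. -/
def IsP : Joint → Prop
  | R _ _ => False
  | P _ _ => True

/-- The unit vector `p_k`: the primal part of the axis of an R-joint, the direction of a P-joint. -/
def dir : Joint → ℍ[ℝ]
  | R h _ => h.fst
  | P p _ => p

/-- The (unoriented) axes or directions of the two joints are parallel. -/
def Parallel (j j' : Joint) : Prop := j'.dir = j.dir ∨ j'.dir = -j.dir

/-- Both joints are R-joints and their axes are the same line; `h` and `-h` represent the same line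
with opposite orientations. -/
def SameAxis : Joint → Joint → Prop
  | R h _, R h' _ => h' = h ∨ h' = -h
  | _, _ => False

/-- Both joints are P-joints and their (unoriented) directions are the same. -/
def SameDirection : Joint → Joint → Prop
  | P p _, P p' _ => p' = p ∨ p' = -p
  | _, _ => False

/-- The values that the complex joint parameter may take, inside the projective line `ℂ ∪ {∞}`: all
of it for the parameter `t` of an R-joint, only finite values for the parameter `s` of a
P-joint. -/
def params : Joint → Set (OnePoint ℂ)
  | R _ _ => Set.univ
  | P _ _ => {x | x ≠ OnePoint.infty}

/-- The motion `m_k` of a joint: `t - h` (and `1` for `t = ∞`) for an R-joint, `1 - ε s p` for a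
P-joint. (The value at `s = ∞` is irrelevant, since `∞` is not an admissible parameter of a
P-joint.) -/
def motion : Joint → OnePoint ℂ → DualQuat ℂ
  | R h _, x => x.elim 1 fun t => algebraMap ℂ (DualQuat ℂ) t - complexifyDual h
  | P p _, x => x.elim 1 fun s => 1 - DualQuat.mk 0 (s • complexifyQuat p)

end Joint

/-- A closed linkage with `n` cyclically arranged joints of type R or P. -/
abbrev Linkage (n : ℕ) : Type := Fin n → Joint

/-- The two standard affine charts of the projective line `ℂ ∪ {∞}`: `z ↦ z` and `z ↦ 1 / z`. -/
def lineChart : Bool → ℂ → OnePoint ℂ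
  | false, z => (z : OnePoint ℂ)
  | true, z => if z = 0 then OnePoint.infty else ((z⁻¹ : ℂ) : OnePoint ℂ)

/-- The negation on the projective line `ℂ ∪ {∞}`, with `-∞ = ∞`. -/
def lineNeg (x : OnePoint ℂ) : OnePoint ℂ := x.map fun z => -z

namespace Linkage

variable {n : ℕ}

/-- The (complex) configuration set: all admissible joint parameters that satisfy the closure
equation `m_1 m_2 ⋯ m_n ≡ 1`, that is, up to a nonzero scalar. -/
def configSet (L : Linkage n) : Set (Fin n → OnePoint ℂ) :=
  {x | (∀ k, x k ∈ (L k).params) ∧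
    ∃ c : ℂ, c ≠ 0 ∧
      (List.ofFn fun k => (L k).motion (x k)).prod = algebraMap ℂ (DualQuat ℂ) c}

/-- A germ at `0` of a holomorphic map from `ℂ^d` to the configuration set, written in the affine
chart of the product of projective lines that is selected by `c`. -/
def IsGerm (L : Linkage n) (c : Fin n → Bool) {d : ℕ} (f : (Fin d → ℂ) → (Fin n → ℂ)) : Prop :=
  AnalyticAt ℂ f 0 ∧ ∀ᶠ z in 𝓝 0, (fun k => lineChart (c k) (f z k)) ∈ L.configSet

/-- The configuration set contains a complex submanifold of dimension `d`, given as the image of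
the germ of a holomorphic immersion. -/
def ContainsManifold (L : Linkage n) (d : ℕ) : Prop :=
  ∃ (c : Fin n → Bool) (f : (Fin d → ℂ) → (Fin n → ℂ)),
    L.IsGerm c f ∧ Function.Injective (fderiv ℂ f 0)

/-- The mobility: the dimension of the configuration set as a complex analytic set, that is, the
largest dimension of a complex manifold contained in it. -/
def mobility (L : Linkage n) : ℕ∞ :=
  ⨆ d ∈ {d : ℕ | L.ContainsManifold d}, (d : ℕ∞)

/-- The linkage is mobile. -/
def Mobile (L : Linkage n) : Prop := 0 < L.mobility

/-- The parameter of the joint `j_k` is not constant during the motion of the linkage: it is not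
constant along some holomorphic arc in the configuration set; equivalently, it is not constant on
some irreducible component of the configuration set. -/
def Moves (L : Linkage n) (k : Fin n) : Prop :=
  ∃ (c : Fin n → Bool) (f : (Fin 1 → ℂ) → (Fin n → ℂ)),
    L.IsGerm c f ∧ ¬ ∀ᶠ z in 𝓝 0, f z k = f 0 k

/-- Two neighbouring R-joints have equal axes, or two neighbouring P-joints have equal directions.
Indices are cyclic. -/
def Degenerate [NeZero n] (L : Linkage n) : Prop :=
  ∃ k : Fin n, (L k).SameAxis (L (k + 1)) ∨ (L k).SameDirection (L (k + 1))

end Linkage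

end

/-! A P-joint moves with primal part `1`, so the primal part of the closure equation only sees the
rotations. The basic fact is that for non-parallel real unit vectors p, q the quaternions 1, p, q,
pq are independent over every field containing ℝ (`quat_independent`).

If (a - bp)(a' - b'q) always lies in the span of 1 and a fixed r, comparing coefficients leaves only
finitely many values for one of the two parameters (`spherical_triangle`). Hence two moving R-joints
whose composite always has a fixed direction are parallel. With two or more P-joints, at most three
rotations remain and any two compose to the inverse of the third up to a scalar, so all axes are
parallel. With one P-joint j₁, parallelism of one of the pairs h₂, h₃ and h₄, h₅ forces that of the
other.

That one of these pairs is parallel needs the dual part. Write the closure equation as (1 -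
εsp₁)m₂m₃ = μ(t₅ + h₅)(t₄ + h₄). If neither pair is parallel, then at a pole of s the normalised
primal parts of both products stay non-zero by independence; so μ is finite there, and the dual
parts show that s is finite, too. To have a pole, infinitely many values of s are combined into one
point over an ultrapower F of ℂ with s ∉ ℂ, and a valuation ring of F containing ℂ but not s is
chosen (`ClosureEq.exists_eq_const`, `ClosureEq.finite`). So s would take finitely many values.

Finally let both pairs be parallel, with p₂, p₄ non-parallel. Then m₂m₃ and m₄m₅ have scalar primal
parts. This ties t₃ to t₂ and t₅ to t₄ by signs, and both composites become circular translations,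
with vectors V₂(t₂) and V₄(t₄) satisfying sp₁ = V₂ + V₄. A linear functional that kills p₁ but not
all of V₂ gives a nontrivial relation between t₂ and t₄. These two determine all other parameters,
so the dimension is at most 1. -/

noncomputable section

/-! ### Quaternions under change of scalars -/

/-- The coefficientwise application of a function to a quaternion. -/
def quatMapFun {R S : Type*} [CommRing R] [CommRing S] (φ : R → S) (q : ℍ[R]) : ℍ[S] :=
  ⟨φ q.re, φ q.imI, φ q.imJ, φ q.imK⟩

section quatMapFun

variable {R S : Type*} [CommRing R] [CommRing S] (φ : R → S)

@[simp] theorem quatMapFun_re (q : ℍ[R]) : (quatMapFun φ q).re = φ q.re := rfl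
@[simp] theorem quatMapFun_imI (q : ℍ[R]) : (quatMapFun φ q).imI = φ q.imI := rfl
@[simp] theorem quatMapFun_imJ (q : ℍ[R]) : (quatMapFun φ q).imJ = φ q.imJ := rfl
@[simp] theorem quatMapFun_imK (q : ℍ[R]) : (quatMapFun φ q).imK = φ q.imK := rfl

end quatMapFun

/-- The map of quaternions induced by a homomorphism of the coefficient rings. -/
def quatMap {R S : Type*} [CommRing R] [CommRing S] (φ : R →+* S) : ℍ[R] →+* ℍ[S] where
  toFun := quatMapFun φ
  map_one' := by ext <;> simp
  map_zero' := by ext <;> simp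
  map_mul' x y := by ext <;> simp
  map_add' x y := by ext <;> simp

section quatMap

variable {R S : Type*} [CommRing R] [CommRing S] (φ : R →+* S)

@[simp] theorem quatMap_re (q : ℍ[R]) : (quatMap φ q).re = φ q.re := rfl
@[simp] theorem quatMap_imI (q : ℍ[R]) : (quatMap φ q).imI = φ q.imI := rfl
@[simp] theorem quatMap_imJ (q : ℍ[R]) : (quatMap φ q).imJ = φ q.imJ := rfl
@[simp] theorem quatMap_imK (q : ℍ[R]) : (quatMap φ q).imK = φ q.imK := rfl

theorem quatMap_smul (a : R) (q : ℍ[R]) : quatMap φ (a • q) = φ a • quatMap φ q := by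
  ext <;> simp

theorem quatMap_comp {T : Type*} [CommRing T] (ψ : S →+* T) (q : ℍ[R]) :
    quatMap ψ (quatMap φ q) = quatMap (ψ.comp φ) q := rfl

theorem quatMap_injective (h : Function.Injective φ) : Function.Injective (quatMap φ) := by
  intro p q hpq
  rw [Quaternion.ext_iff] at hpq ⊢
  exact ⟨h hpq.1, h hpq.2.1, h hpq.2.2.1, h hpq.2.2.2⟩

end quatMap

theorem complexifyQuat_eq (q : ℍ[ℝ]) : complexifyQuat q = quatMap Complex.ofRealHom q := rfl

/-! ### Independence of 1, p, q, pq -/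

/-- A real quaternion with square `-1` is a pure unit quaternion. -/
theorem re_eq_zero_of_mul_self {p : ℍ[ℝ]} (hp : p * p = -1) :
    p.re = 0 ∧ p.imI ^ 2 + p.imJ ^ 2 + p.imK ^ 2 = 1 := by
  have h0 := congrArg (fun q : ℍ[ℝ] => q.re) hp
  have h1 := congrArg (fun q : ℍ[ℝ] => q.imI) hp
  have h2 := congrArg (fun q : ℍ[ℝ] => q.imJ) hp
  have h3 := congrArg (fun q : ℍ[ℝ] => q.imK) hp
  simp at h0 h1 h2 h3
  have hre : p.re = 0 := by
    by_contra hne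
    have e1 : p.imI = 0 := mul_left_cancel₀ hne (by linarith)
    have e2 : p.imJ = 0 := mul_left_cancel₀ hne (by linarith)
    have e3 : p.imK = 0 := mul_left_cancel₀ hne (by linarith)
    rw [e1, e2, e3] at h0
    nlinarith [sq_nonneg p.re]
  refine ⟨hre, ?_⟩
  rw [hre] at h0
  linarith

theorem eq_zero_of_sum_sq {x y z : ℝ} (h : x ^ 2 + y ^ 2 + z ^ 2 = 0) :
    x = 0 ∧ y = 0 ∧ z = 0 :=
  ⟨pow_eq_zero_iff two_ne_zero |>.mp (by nlinarith [sq_nonneg x, sq_nonneg y, sq_nonneg z]),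
    pow_eq_zero_iff two_ne_zero |>.mp (by nlinarith [sq_nonneg x, sq_nonneg y, sq_nonneg z]),
    pow_eq_zero_iff two_ne_zero |>.mp (by nlinarith [sq_nonneg x, sq_nonneg y, sq_nonneg z])⟩

/-- For two non-parallel real unit vectors `p` and `q`, the quaternions `1, p, q, pq` are linearly
independent over any field that contains the real numbers. -/
theorem quat_independent {k : Type*} [Field k] (θ : ℝ →+* k) {p q : ℍ[ℝ]} (hp : p * p = -1)
    (hq : q * q = -1) (h1 : q ≠ p) (h2 : q ≠ -p) {α β γ δ : k}
    (h : α • (1 : ℍ[k]) + β • quatMap θ p + γ • quatMap θ q + δ • (quatMap θ p * quatMap θ q) = 0) :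
    α = 0 ∧ β = 0 ∧ γ = 0 ∧ δ = 0 := by
  obtain ⟨hp0, hpn⟩ := re_eq_zero_of_mul_self hp
  obtain ⟨hq0, hqn⟩ := re_eq_zero_of_mul_self hq
  set u1 := p.imJ * q.imK - p.imK * q.imJ with hu1
  set u2 := p.imK * q.imI - p.imI * q.imK with hu2
  set u3 := p.imI * q.imJ - p.imJ * q.imI with hu3
  -- By Lagrange, |p × q|² + (p·q)² = 1. If p × q = 0, then r = p·q = ±1 and |q - rp|² = 0. Over ℝ
  -- this gives q = ±p; complex vectors could be isotropic.
  have hN : u1 ^ 2 + u2 ^ 2 + u3 ^ 2 ≠ 0 := by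
    intro h0
    set r := p.imI * q.imI + p.imJ * q.imJ + p.imK * q.imK with hr
    have hr1 : r ^ 2 = 1 := by
      have : u1 ^ 2 + u2 ^ 2 + u3 ^ 2 + r ^ 2 =
        (p.imI ^ 2 + p.imJ ^ 2 + p.imK ^ 2) * (q.imI ^ 2 + q.imJ ^ 2 + q.imK ^ 2) := by
        rw [hu1, hu2, hu3, hr]; ring
      rw [hpn, hqn, h0] at this; linarith
    have hd : (q.imI - r * p.imI) ^ 2 + (q.imJ - r * p.imJ) ^ 2 + (q.imK - r * p.imK) ^ 2 = 0 := by
      have : (q.imI - r * p.imI) ^ 2 + (q.imJ - r * p.imJ) ^ 2 + (q.imK - r * p.imK) ^ 2 =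
        (q.imI ^ 2 + q.imJ ^ 2 + q.imK ^ 2) - 2 * r * r +
          r ^ 2 * (p.imI ^ 2 + p.imJ ^ 2 + p.imK ^ 2) := by rw [hr]; ring
      rw [this, hpn, hqn]; linarith
    obtain ⟨dI, dJ, dK⟩ := eq_zero_of_sum_sq hd
    have e1 : q.imI = r * p.imI := by linarith [dI]
    have e2 : q.imJ = r * p.imJ := by linarith [dJ]
    have e3 : q.imK = r * p.imK := by linarith [dK]
    rcases eq_or_eq_neg_of_sq_eq_sq r 1 (by rw [hr1, one_pow]) with hr' | hr'
    · apply h1; ext <;> simp [hp0, hq0, e1, e2, e3, hr']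
    · apply h2; ext <;> simp [hp0, hq0, e1, e2, e3, hr']
  have hN' : θ (u1 ^ 2 + u2 ^ 2 + u3 ^ 2) ≠ 0 := (map_ne_zero θ).mpr hN
  have c0 := congrArg (fun q : ℍ[k] => q.re) h
  have c1 := congrArg (fun q : ℍ[k] => q.imI) h
  have c2 := congrArg (fun q : ℍ[k] => q.imJ) h
  have c3 := congrArg (fun q : ℍ[k] => q.imK) h
  simp [hp0, hq0] at c0 c1 c2 c3
  rw [hu1, hu2, hu3] at hN'
  simp only [map_add, map_sub, map_mul, map_pow] at hN'
  generalize θ p.imI = P1 at *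
  generalize θ p.imJ = P2 at *
  generalize θ p.imK = P3 at *
  generalize θ q.imI = Q1 at *
  generalize θ q.imJ = Q2 at *
  generalize θ q.imK = Q3 at *
  -- The vector part reads βp + γq + δ(p × q) = 0. It is paired with p × q, first directly, then
  -- after a cross product with q or with p.
  have hδ : δ = 0 := by
    refine (mul_eq_zero.mp ?_).resolve_right hN'
    linear_combination (P2 * Q3 - P3 * Q2) * c1 + (P3 * Q1 - P1 * Q3) * c2 +
      (P1 * Q2 - P2 * Q1) * c3
  subst hδ
  have hβ : β = 0 := by
    refine (mul_eq_zero.mp ?_).resolve_right hN'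
    linear_combination (P2 * Q3 - P3 * Q2) * (Q3 * c2 - Q2 * c3) +
      (P3 * Q1 - P1 * Q3) * (Q1 * c3 - Q3 * c1) + (P1 * Q2 - P2 * Q1) * (Q2 * c1 - Q1 * c2)
  subst hβ
  have hγ : γ = 0 := by
    refine (mul_eq_zero.mp ?_).resolve_right hN'
    linear_combination (P2 * Q3 - P3 * Q2) * (P2 * c3 - P3 * c2) +
      (P3 * Q1 - P1 * Q3) * (P3 * c1 - P1 * c3) + (P1 * Q2 - P2 * Q1) * (P1 * c2 - P2 * c1)
  subst hγ
  refine ⟨?_, rfl, rfl, rfl⟩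
  simpa using c0

/-- The primal part `a - b p` of the motion of an R-joint with homogeneous parameter `(a : b)`. -/
def lin {R : Type*} [CommRing R] (θ : ℝ →+* R) (p : ℍ[ℝ]) (a b : R) : ℍ[R] :=
  a • (1 : ℍ[R]) - b • quatMap θ p

theorem quatMap_lin {R S : Type*} [CommRing R] [CommRing S] (θ : ℝ →+* R) (φ : R →+* S)
    (p : ℍ[ℝ]) (a b : R) : quatMap φ (lin θ p a b) = lin (φ.comp θ) p (φ a) (φ b) := by
  simp [lin, quatMap_smul, quatMap_comp]

theorem lin_mul_lin {R : Type*} [CommRing R] (θ : ℝ →+* R) (p q : ℍ[ℝ]) (a b a' b' : R) :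
    lin θ p a b * lin θ q a' b' = (a * a') • (1 : ℍ[R]) + (-(a' * b)) • quatMap θ p +
      (-(a * b')) • quatMap θ q + (b * b') • (quatMap θ p * quatMap θ q) := by
  simp only [lin, sub_mul, mul_sub, smul_mul_assoc, mul_smul_comm, one_mul, mul_one]
  module

/-- Up to sign, the coefficients with respect to 1, p, q, pq are the four products of one of a, b
with one of a', b'. They do not all vanish. This will be applied over a residue field. -/
theorem lin_mul_lin_ne_zero {k : Type*} [Field k] (θ : ℝ →+* k) {p q : ℍ[ℝ]} (hp : p * p = -1)
    (hq : q * q = -1) (h1 : q ≠ p) (h2 : q ≠ -p) {a b a' b' : k} (hab : a ≠ 0 ∨ b ≠ 0)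
    (hab' : a' ≠ 0 ∨ b' ≠ 0) : lin θ p a b * lin θ q a' b' ≠ 0 := by
  intro h
  rw [lin_mul_lin] at h
  obtain ⟨e1, e2, e3, e4⟩ := quat_independent θ hp hq h1 h2 h
  grind

/-! ### The prismatic parameter has no poles -/

/-- If `s p A + A' + μ B' = 0` and `A = μ B` where `A` and `B` do not vanish modulo the maximal
ideal of a valuation ring, then `s` belongs to that valuation ring. -/
theorem mem_valuationSubring {F : Type*} [Field F] (O : ValuationSubring F) (s μ : F)
    (A B A' B' P : ℍ[O]) (hP : P * P = -1) (hA : quatMap (IsLocalRing.residue O) A ≠ 0)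
    (hB : quatMap (IsLocalRing.residue O) B ≠ 0)
    (h1 : quatMap O.subtype A = μ • quatMap O.subtype B)
    (h2 : s • quatMap O.subtype (P * A) + quatMap O.subtype A' + μ • quatMap O.subtype B' = 0) :
    s ∈ O := by
  -- A coordinate of `B` with non-zero residue is a unit of `O`; dividing the same coordinate of A =
  -- μB by it exhibits μ as an element of `O`.
  have key : ∀ x y : O, IsLocalRing.residue O y ≠ 0 → (x : F) = μ * y → μ ∈ O := by
    intro x y hy hxy
    have hu : IsUnit y := IsLocalRing.residue_ne_zero_iff_isUnit y |>.mp hy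
    obtain ⟨u, rfl⟩ := hu
    have : μ = ((x * (u⁻¹ : Oˣ) : O) : F) := by
      have e : ((u : O) : F) * (((u⁻¹ : Oˣ) : O) : F) = 1 := by
        exact congrArg O.subtype (Units.mul_inv u)
      push_cast
      rw [hxy, mul_assoc, e, mul_one]
    rw [this]
    exact SetLike.coe_mem _
  have hμ : μ ∈ O := by
    rw [Quaternion.ext_iff] at h1
    obtain ⟨e0, e1, e2, e3⟩ := h1
    by_contra hn
    apply hB
    ext
    · by_contra h; exact hn (key _ _ h e0)
    · by_contra h; exact hn (key _ _ h e1)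
    · by_contra h; exact hn (key _ _ h e2)
    · by_contra h; exact hn (key _ _ h e3)
  by_contra hs
  have hs0 : s ≠ 0 := by rintro rfl; exact hs O.zero_mem
  have hu : s⁻¹ ∈ O := (O.mem_or_inv_mem s).resolve_left hs
  set u : O := ⟨s⁻¹, hu⟩ with hudef
  set m : O := ⟨μ, hμ⟩ with hmdef
  -- As `s ∉ O`, its inverse is a non-unit. Dividing `h2` by `s` and reducing therefore leaves only
  -- `P * A`, and `P` is invertible.
  have hres : IsLocalRing.residue O u = 0 := by
    by_contra h
    have h' : IsUnit u := IsLocalRing.residue_ne_zero_iff_isUnit u |>.mp h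
    obtain ⟨v, hv⟩ := h'.exists_right_inv
    have hv' := congrArg O.subtype hv
    have : s = v := by
      simp [hudef] at hv'
      field_simp at hv'
      exact hv'.symm
    exact hs (this ▸ v.2)
  have h3 : P * A + u • (A' + m • B') = 0 := by
    apply quatMap_injective O.subtype Subtype.val_injective
    rw [map_add, quatMap_smul, map_add, quatMap_smul, map_zero]
    change _ + s⁻¹ • (_ + μ • _) = 0
    have := congrArg (fun q => s⁻¹ • q) h2
    simp only [smul_add, smul_zero, inv_smul_smul₀ hs0] at this
    rw [smul_add, ← add_assoc, this]
  have h4 := congrArg (quatMap (IsLocalRing.residue O)) h3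
  rw [map_add, quatMap_smul, hres, zero_smul, add_zero, map_zero, map_mul] at h4
  have hP' : quatMap (IsLocalRing.residue O) P * quatMap (IsLocalRing.residue O) P = -1 := by
    rw [← map_mul, hP, map_neg, map_one]
  apply hA
  have := congrArg (fun q => -(quatMap (IsLocalRing.residue O) P * q)) h4
  simpa [← mul_assoc, hP'] using this

/-- A point of the projective line over the fraction field of a valuation ring has coprime
homogeneous coordinates in the valuation ring. -/
theorem exists_primitive {F : Type*} [Field F] (O : ValuationSubring F) (a b : F)
    (h : a ≠ 0 ∨ b ≠ 0) : ∃ (ρ : F) (a' b' : O), ρ ≠ 0 ∧ a = ρ * a' ∧ b = ρ * b' ∧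
      (IsLocalRing.residue O a' ≠ 0 ∨ IsLocalRing.residue O b' ≠ 0) := by
  have key : ∀ a b : F, b ≠ 0 → a / b ∈ O → ∃ (ρ : F) (a' b' : O), ρ ≠ 0 ∧ a = ρ * a' ∧ b = ρ * b' ∧
      (IsLocalRing.residue O a' ≠ 0 ∨ IsLocalRing.residue O b' ≠ 0) := by
    intro a b hb hab
    refine ⟨b, ⟨a / b, hab⟩, 1, hb, ?_, by simp, Or.inr (by simp)⟩
    simp only []
    field_simp
  by_cases hb : b = 0
  · subst hb
    have ha : a ≠ 0 := by simpa using h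
    obtain ⟨ρ, a', b', h1, h2, h3, h4⟩ := key 0 a ha (by simp)
    exact ⟨ρ, b', a', h1, h3, h2, h4.symm⟩
  · rcases O.mem_or_inv_mem (a / b) with h1 | h1
    · exact key a b hb h1
    · by_cases ha : a = 0
      · exact key a b hb (by simp [ha])
      · rw [inv_div] at h1
        obtain ⟨ρ, a', b', h1, h2, h3, h4⟩ := key b a ha h1
        exact ⟨ρ, b', a', h1, h3, h2, h4.symm⟩

/-- The image of an algebraically closed field is integrally closed in `F`, hence the intersection
of the valuation rings that contain it. The ring found here is a place over `k` at which `s` has a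
pole. -/
theorem exists_valuationSubring_notMem {k F : Type*} [Field k] [IsAlgClosed k] [Field F]
    (φ : k →+* F) {s : F} (hs : ∀ c, s ≠ φ c) :
    ∃ O : ValuationSubring F, (∀ c, φ c ∈ O) ∧ s ∉ O := by
  have hcl : IsIntegrallyClosedIn φ.range F := by
    rw [Subring.isIntegrallyClosedIn_iff]
    intro x hx
    let _ := φ.toAlgebra
    have hx' : IsIntegral k x := by
      obtain ⟨P, hP, hP'⟩ := hx
      obtain ⟨Q, hQ, -, hQm⟩ := Polynomial.lifts_and_natDegree_eq_and_monic
        (f := φ.rangeRestrict) (p := P) (by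
          rw [Polynomial.lifts_iff_coeff_lifts]
          exact fun n => φ.rangeRestrict_surjective _) hP
      refine ⟨Q, hQm, ?_⟩
      rw [← hQ, Polynomial.eval₂_map] at hP'
      exact hP'
    obtain ⟨c, hc⟩ := IsAlgClosed.algebraMap_bijective_of_isIntegral (k := k)
      (K := integralClosure k F) |>.2 ⟨x, hx'⟩
    exact ⟨c, congrArg Subtype.val hc⟩
  obtain ⟨V, hV, hsV⟩ := Subring.exists_le_valuationSubring_of_isIntegrallyClosedIn
    (x := s) (R := φ.range) (by rintro ⟨c, hc⟩; exact hs c hc.symm)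
  exact ⟨V, fun c => hV ⟨c, rfl⟩, hsV⟩

theorem lin_mul_left {R : Type*} [CommRing R] (θ : ℝ →+* R) (p : ℍ[ℝ]) (ρ a b : R) :
    lin θ p (ρ * a) (ρ * b) = ρ • lin θ p a b := by
  simp only [lin]; module

/-- The dual part of `(a - b (p + ε q)) (a' - b' (p' + ε q'))`. -/
def linDual {R : Type*} [CommRing R] (θ : ℝ →+* R) (p q : ℍ[ℝ]) (a b : R) (p' q' : ℍ[ℝ])
    (a' b' : R) : ℍ[R] :=
  -(b' • (lin θ p a b * quatMap θ q')) - b • (quatMap θ q * lin θ p' a' b')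

theorem quatMap_linDual {R S : Type*} [CommRing R] [CommRing S] (θ : ℝ →+* R) (φ : R →+* S)
    (p q : ℍ[ℝ]) (a b : R) (p' q' : ℍ[ℝ]) (a' b' : R) :
    quatMap φ (linDual θ p q a b p' q' a' b') =
      linDual (φ.comp θ) p q (φ a) (φ b) p' q' (φ a') (φ b') := by
  simp [linDual, quatMap_smul, quatMap_lin, quatMap_comp]

theorem linDual_mul_left {R : Type*} [CommRing R] (θ : ℝ →+* R) (p q : ℍ[ℝ]) (ρ a b : R)
    (p' q' : ℍ[ℝ]) (ρ' a' b' : R) :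
    linDual θ p q (ρ * a) (ρ * b) p' q' (ρ' * a') (ρ' * b') =
      (ρ * ρ') • linDual θ p q a b p' q' a' b' := by
  simp only [linDual, lin_mul_left, smul_mul_assoc, mul_smul_comm]
  module

/-- The primal and the dual part of the closure equation
`(1 - ε s p₁) (a₂ - b₂ h₂) (a₃ - b₃ h₃) = μ (a₅ + b₅ h₅) (a₄ + b₄ h₄)`. -/
structure ClosureEq {R : Type*} [CommRing R] (θ : ℝ →+* R) (p₁ p₂ q₂ p₃ q₃ p₄ q₄ p₅ q₅ : ℍ[ℝ])
    (s μ a₂ b₂ a₃ b₃ a₄ b₄ a₅ b₅ : R) : Prop where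
  primal : lin θ p₂ a₂ b₂ * lin θ p₃ a₃ b₃ = μ • (lin θ p₅ a₅ (-b₅) * lin θ p₄ a₄ (-b₄))
  dual : linDual θ p₂ q₂ a₂ b₂ p₃ q₃ a₃ b₃ -
      s • (quatMap θ p₁ * (lin θ p₂ a₂ b₂ * lin θ p₃ a₃ b₃)) =
    μ • linDual θ p₅ q₅ a₅ (-b₅) p₄ q₄ a₄ (-b₄)

/-- If neither `h₂, h₃` nor `h₄, h₅` are parallel, then the parameter of the P-joint is a constant
in every field valued point of the configuration set. -/
theorem ClosureEq.exists_eq_const {F : Type*} [Field F] (φ : ℂ →+* F)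
    {p₁ p₂ q₂ p₃ q₃ p₄ q₄ p₅ q₅ : ℍ[ℝ]} (h₁ : p₁ * p₁ = -1) (h₂ : p₂ * p₂ = -1)
    (h₃ : p₃ * p₃ = -1) (h₄ : p₄ * p₄ = -1) (h₅ : p₅ * p₅ = -1) (n23 : p₃ ≠ p₂) (n23' : p₃ ≠ -p₂)
    (n54 : p₄ ≠ p₅) (n54' : p₄ ≠ -p₅) {s μ a₂ b₂ a₃ b₃ a₄ b₄ a₅ b₅ : F}
    (h : ClosureEq (φ.comp Complex.ofRealHom) p₁ p₂ q₂ p₃ q₃ p₄ q₄ p₅ q₅ s μ a₂ b₂ a₃ b₃ a₄ b₄ a₅ b₅)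
    (c₂ : a₂ ≠ 0 ∨ b₂ ≠ 0) (c₃ : a₃ ≠ 0 ∨ b₃ ≠ 0) (c₄ : a₄ ≠ 0 ∨ b₄ ≠ 0) (c₅ : a₅ ≠ 0 ∨ b₅ ≠ 0) :
    ∃ c, s = φ c := by
  by_contra! hs
  obtain ⟨O, hO, hsO⟩ := exists_valuationSubring_notMem φ hs
  apply hsO
  let θO : ℝ →+* O := (φ.codRestrict O.toSubring hO).comp Complex.ofRealHom
  have hθ : O.subtype.comp θO = φ.comp Complex.ofRealHom := rfl
  -- Making the coordinates primitive replaces μ by μρ₅ρ₄/(ρ₂ρ₃) and leaves `s` unchanged.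
  obtain ⟨ρ₂, α₂, β₂, r₂, rfl, rfl, u₂⟩ := exists_primitive O a₂ b₂ c₂
  obtain ⟨ρ₃, α₃, β₃, r₃, rfl, rfl, u₃⟩ := exists_primitive O a₃ b₃ c₃
  obtain ⟨ρ₄, α₄, β₄, r₄, rfl, rfl, u₄⟩ := exists_primitive O a₄ b₄ c₄
  obtain ⟨ρ₅, α₅, β₅, r₅, rfl, rfl, u₅⟩ := exists_primitive O a₅ b₅ c₅
  have e1 := h.primal
  have e2 := h.dual
  simp only [← mul_neg, lin_mul_left, linDual_mul_left, smul_mul_assoc, mul_smul_comm,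
    smul_smul] at e1 e2
  refine mem_valuationSubring O s (μ * (ρ₅ * ρ₄) / (ρ₂ * ρ₃))
    (lin θO p₂ α₂ β₂ * lin θO p₃ α₃ β₃) (lin θO p₅ α₅ (-β₅) * lin θO p₄ α₄ (-β₄))
    (-linDual θO p₂ q₂ α₂ β₂ p₃ q₃ α₃ β₃) (linDual θO p₅ q₅ α₅ (-β₅) p₄ q₄ α₄ (-β₄))
    (quatMap θO p₁) ?_ ?_ ?_ ?_ ?_
  · rw [← map_mul, h₁, map_neg, map_one]
  · rw [map_mul, quatMap_lin, quatMap_lin]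
    exact lin_mul_lin_ne_zero _ h₂ h₃ n23 n23' u₂ u₃
  · rw [map_mul, quatMap_lin, quatMap_lin, map_neg, map_neg]
    exact lin_mul_lin_ne_zero _ h₅ h₄ n54 n54' (by simpa using u₅) (by simpa using u₄)
  · rw [map_mul, quatMap_lin, quatMap_lin, map_mul, quatMap_lin, quatMap_lin, hθ, map_neg, map_neg]
    simp only [ValuationSubring.subtype_apply]
    have := congrArg (fun q => (ρ₂ * ρ₃)⁻¹ • q) e1
    simp only [smul_smul] at this
    rw [show (ρ₂ * ρ₃)⁻¹ * (ρ₃ * ρ₂) = 1 by field_simp, one_smul] at this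
    rw [this]
    congr 1
    field_simp
  · simp only [map_mul, quatMap_lin, quatMap_linDual, quatMap_comp, hθ, map_neg,
      ValuationSubring.subtype_apply]
    have := congrArg (fun q => (ρ₂ * ρ₃)⁻¹ • q) e2
    simp only [smul_smul, smul_sub] at this
    rw [show (ρ₂ * ρ₃)⁻¹ * (ρ₂ * ρ₃) = 1 by field_simp, one_smul,
      show (ρ₂ * ρ₃)⁻¹ * (s * (ρ₃ * ρ₂)) = s by field_simp,
      show (ρ₂ * ρ₃)⁻¹ * (μ * (ρ₅ * ρ₄)) = μ * (ρ₅ * ρ₄) / (ρ₂ * ρ₃) by field_simp] at this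
    rw [← this]
    abel

/-! ### Finiteness by passing to an ultrapower -/

theorem quat_pi_ext {Q Q' : ℍ[ℕ → ℂ]}
    (h : ∀ n, quatMap (Pi.evalRingHom (fun _ : ℕ => ℂ) n) Q =
      quatMap (Pi.evalRingHom (fun _ : ℕ => ℂ) n) Q') : Q = Q' := by
  simp only [Quaternion.ext_iff] at h
  ext n
  · exact (h n).1
  · exact (h n).2.1
  · exact (h n).2.2.1
  · exact (h n).2.2.2

theorem ClosureEq.map {R S : Type*} [CommRing R] [CommRing S] {θ : ℝ →+* R} (φ : R →+* S)
    {p₁ p₂ q₂ p₃ q₃ p₄ q₄ p₅ q₅ : ℍ[ℝ]} {s μ a₂ b₂ a₃ b₃ a₄ b₄ a₅ b₅ : R}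
    (h : ClosureEq θ p₁ p₂ q₂ p₃ q₃ p₄ q₄ p₅ q₅ s μ a₂ b₂ a₃ b₃ a₄ b₄ a₅ b₅) :
    ClosureEq (φ.comp θ) p₁ p₂ q₂ p₃ q₃ p₄ q₄ p₅ q₅ (φ s) (φ μ) (φ a₂) (φ b₂) (φ a₃) (φ b₃)
      (φ a₄) (φ b₄) (φ a₅) (φ b₅) := by
  constructor
  · have := congrArg (quatMap φ) h.primal
    simpa [quatMap_smul, quatMap_lin] using this
  · have := congrArg (quatMap φ) h.dual
    simpa [quatMap_smul, quatMap_lin, quatMap_linDual, quatMap_comp] using this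

theorem ClosureEq.of_forall {p₁ p₂ q₂ p₃ q₃ p₄ q₄ p₅ q₅ : ℍ[ℝ]}
    {s μ a₂ b₂ a₃ b₃ a₄ b₄ a₅ b₅ : ℕ → ℂ}
    (h : ∀ n, ClosureEq Complex.ofRealHom p₁ p₂ q₂ p₃ q₃ p₄ q₄ p₅ q₅ (s n) (μ n) (a₂ n) (b₂ n)
      (a₃ n) (b₃ n) (a₄ n) (b₄ n) (a₅ n) (b₅ n)) :
    ClosureEq ((algebraMap ℂ (ℕ → ℂ)).comp Complex.ofRealHom) p₁ p₂ q₂ p₃ q₃ p₄ q₄ p₅ q₅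
      s μ a₂ b₂ a₃ b₃ a₄ b₄ a₅ b₅ := by
  have hev : ∀ n, (Pi.evalRingHom (fun _ : ℕ => ℂ) n).comp
    ((algebraMap ℂ (ℕ → ℂ)).comp Complex.ofRealHom) = Complex.ofRealHom := fun _ => rfl
  constructor
  · refine quat_pi_ext fun n => ?_
    simpa [quatMap_smul, quatMap_lin, hev] using (h n).primal
  · refine quat_pi_ext fun n => ?_
    simpa [quatMap_smul, quatMap_lin, quatMap_linDual, quatMap_comp, hev] using (h n).dual

/-- If neither `h₂, h₃` nor `h₄, h₅` are parallel, then the parameter of the P-joint takes only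
finitely many values. -/
theorem ClosureEq.finite {p₁ p₂ q₂ p₃ q₃ p₄ q₄ p₅ q₅ : ℍ[ℝ]} (h₁ : p₁ * p₁ = -1)
    (h₂ : p₂ * p₂ = -1) (h₃ : p₃ * p₃ = -1) (h₄ : p₄ * p₄ = -1) (h₅ : p₅ * p₅ = -1)
    (n23 : p₃ ≠ p₂) (n23' : p₃ ≠ -p₂) (n54 : p₄ ≠ p₅) (n54' : p₄ ≠ -p₅) :
    {s : ℂ | ∃ μ a₂ b₂ a₃ b₃ a₄ b₄ a₅ b₅,
      ClosureEq Complex.ofRealHom p₁ p₂ q₂ p₃ q₃ p₄ q₄ p₅ q₅ s μ a₂ b₂ a₃ b₃ a₄ b₄ a₅ b₅ ∧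
      (a₂ ≠ 0 ∨ b₂ ≠ 0) ∧ (a₃ ≠ 0 ∨ b₃ ≠ 0) ∧ (a₄ ≠ 0 ∨ b₄ ≠ 0) ∧ (a₅ ≠ 0 ∨ b₅ ≠ 0)}.Finite := by
  by_contra hinf
  let g := Set.Infinite.natEmbedding _ hinf
  choose μ a₂ b₂ a₃ b₃ a₄ b₄ a₅ b₅ hg c₂ c₃ c₄ c₅ using fun n => (g n).2
  -- Infinitely many configurations with distinct `s` become a single point over the ultrapower of
  -- ℂ.
  let U : Ultrafilter ℕ := Filter.hyperfilter ℕ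
  let π : (ℕ → ℂ) →+* Filter.Germ (U : Filter ℕ) ℂ := Filter.Germ.coeRingHom (U : Filter ℕ)
  have hne : ∀ a b : ℕ → ℂ, (∀ n, a n ≠ 0 ∨ b n ≠ 0) → π a ≠ 0 ∨ π b ≠ 0 := by
    intro a b hab
    by_contra! h
    have h1 : ∀ᶠ n in (U : Filter ℕ), a n = 0 := Filter.Germ.coe_eq.mp h.1
    have h2 : ∀ᶠ n in (U : Filter ℕ), b n = 0 := Filter.Germ.coe_eq.mp h.2
    obtain ⟨n, hn1, hn2⟩ := (h1.and h2).exists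
    exact (hab n).elim (· hn1) (· hn2)
  obtain ⟨c, hc⟩ := ((ClosureEq.of_forall hg).map π).exists_eq_const
    (π.comp (algebraMap ℂ (ℕ → ℂ))) h₁ h₂ h₃ h₄ h₅ n23 n23' n54 n54'
    (hne _ _ c₂) (hne _ _ c₃) (hne _ _ c₄) (hne _ _ c₅)
  have hev : ∀ᶠ n in (U : Filter ℕ), (g n : ℂ) = c := Filter.Germ.coe_eq.mp hc
  -- An injective sequence takes the value `c` at most once, and a non-principal ultrafilter
  -- contains no finite set.
  have hfin : {n | (g n : ℂ) = c}.Finite := by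
    refine Set.Subsingleton.finite ?_
    intro m hm n hn
    exact g.injective (Subtype.ext (hm.trans hn.symm))
  exact hfin.notMem_hyperfilter hev

/-! ### Homogeneous joint parameters and rotated closure equations -/

/-- The numerator of a point of the projective line. -/
def lineNum (x : OnePoint ℂ) : ℂ := x.elim 1 id

/-- The denominator of a point of the projective line. -/
def lineDen (x : OnePoint ℂ) : ℂ := x.elim 0 fun _ => 1

@[simp] theorem lineNum_coe (t : ℂ) : lineNum (t : OnePoint ℂ) = t := rfl
@[simp] theorem lineDen_coe (t : ℂ) : lineDen (t : OnePoint ℂ) = 1 := rfl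
@[simp] theorem lineNum_infty : lineNum OnePoint.infty = 1 := rfl
@[simp] theorem lineDen_infty : lineDen OnePoint.infty = 0 := rfl

theorem lineNum_or_lineDen_ne_zero (x : OnePoint ℂ) : lineNum x ≠ 0 ∨ lineDen x ≠ 0 := by
  induction x using OnePoint.rec <;> simp

namespace Joint

/-- The numerator of the parameter of an R-joint; for a P-joint, a value that makes the
primal part of the motion equal to `1`. -/
def num : Joint → OnePoint ℂ → ℂ
  | R _ _, x => lineNum x
  | P _ _, _ => 1

/-- The denominator of the parameter of an R-joint; for a P-joint, a value that makes the
primal part of the motion equal to `1`. -/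
def den : Joint → OnePoint ℂ → ℂ
  | R _ _, x => lineDen x
  | P _ _, _ => 0

theorem dir_mul_dir : ∀ j : Joint, j.dir * j.dir = -1
  | R h sq => by
    have := congrArg TrivSqZeroExt.fst sq
    simpa [dir] using this
  | P _ sq => sq

theorem num_or_den_ne_zero (x : OnePoint ℂ) : ∀ j : Joint, j.num x ≠ 0 ∨ j.den x ≠ 0
  | R _ _ => lineNum_or_lineDen_ne_zero x
  | P _ _ => Or.inl one_ne_zero

theorem den_of_isP {j : Joint} (h : j.IsP) (x : OnePoint ℂ) : j.den x = 0 := by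
  cases j with
  | R => exact h.elim
  | P => rfl

theorem fst_motion_R (h : DualQuat ℝ) (sq : h * h = -1) (x : OnePoint ℂ) :
    ((R h sq).motion x).fst = lin Complex.ofRealHom h.fst (lineNum x) (lineDen x) := by
  induction x using OnePoint.rec with
  | infty => simp [motion, lin]
  | coe t =>
    simp [motion, lin, complexifyDual, complexifyQuat_eq, Algebra.algebraMap_eq_smul_one]

theorem snd_motion_R (h : DualQuat ℝ) (sq : h * h = -1) (x : OnePoint ℂ) :
    ((R h sq).motion x).snd = -(lineDen x • quatMap Complex.ofRealHom h.snd) := by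
  induction x using OnePoint.rec with
  | infty => simp [motion]
  | coe t =>
    simp [motion, complexifyDual, complexifyQuat_eq, Algebra.algebraMap_eq_smul_one]

theorem fst_motion (x : OnePoint ℂ) :
    ∀ j : Joint, (j.motion x).fst = lin Complex.ofRealHom j.dir (j.num x) (j.den x)
  | R h sq => fst_motion_R h sq x
  | P p sq => by
    induction x using OnePoint.rec <;> simp [motion, lin, num, den]

end Joint

theorem quat_isUnit_of_normSq {q : ℍ[ℂ]} (h : Quaternion.normSq q ≠ 0) : IsUnit q := by
  have h1 : ((Quaternion.normSq q : ℂ) : ℍ[ℂ]) * (((Quaternion.normSq q)⁻¹ : ℂ) : ℍ[ℂ]) = 1 := by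
    rw [← Quaternion.coe_mul, mul_inv_cancel₀ h, Quaternion.coe_one]
  refine ⟨⟨q, star q * (((Quaternion.normSq q)⁻¹ : ℂ) : ℍ[ℂ]), ?_, ?_⟩, rfl⟩
  · rw [← mul_assoc, Quaternion.self_mul_star, h1]
  · rw [← Quaternion.coe_commutes, mul_assoc, Quaternion.star_mul_self, Quaternion.coe_commutes, h1]

/-- A factorization of a nonzero scalar may be rotated. -/
theorem mul_eq_algebraMap_comm {x y : DualQuat ℂ} {c : ℂ} (hc : c ≠ 0)
    (h : x * y = algebraMap ℂ (DualQuat ℂ) c) : y * x = algebraMap ℂ (DualQuat ℂ) c := by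
  -- Complex quaternions have zero divisors; multiplicativity of the norm shows that `x` is a unit.
  have h1 : Quaternion.normSq x.fst * Quaternion.normSq y.fst = c ^ 2 := by
    have := congrArg (fun z : DualQuat ℂ => Quaternion.normSq z.fst) h
    simpa [Algebra.algebraMap_eq_smul_one, Quaternion.normSq_smul] using this
  have hx : IsUnit x := by
    rw [TrivSqZeroExt.isUnit_iff_isUnit_fst]
    apply quat_isUnit_of_normSq
    intro h0
    rw [h0, zero_mul] at h1
    exact pow_ne_zero 2 hc h1.symm
  obtain ⟨u, rfl⟩ := hx
  have : y = (u⁻¹ : (DualQuat ℂ)ˣ) * algebraMap ℂ (DualQuat ℂ) c := by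
    rw [← h, ← mul_assoc, Units.inv_mul, one_mul]
  rw [this, mul_assoc, Algebra.commutes c, ← mul_assoc, Units.inv_mul, one_mul]

namespace Linkage

variable {L : Linkage 5} {x : Fin 5 → OnePoint ℂ}

theorem closure_rotate (hx : x ∈ L.configSet) : ∃ c : ℂ, c ≠ 0 ∧ ∀ i : Fin 5,
    (L i).motion (x i) * (L (i + 1)).motion (x (i + 1)) * (L (i + 2)).motion (x (i + 2)) *
      (L (i + 3)).motion (x (i + 3)) * (L (i + 4)).motion (x (i + 4)) =
        algebraMap ℂ (DualQuat ℂ) c := by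
  obtain ⟨-, c, hc, h⟩ := hx
  simp only [List.ofFn_succ, List.ofFn_zero, List.prod_cons, List.prod_nil, mul_one] at h
  refine ⟨c, hc, ?_⟩
  have h0 : ∀ a b c' d e : DualQuat ℂ, a * (b * (c' * (d * e))) = algebraMap ℂ (DualQuat ℂ) c →
      b * (c' * (d * (e * a))) = algebraMap ℂ (DualQuat ℂ) c := by
    intro a b c' d e h
    have := mul_eq_algebraMap_comm hc h
    simpa only [mul_assoc] using this
  have h1 := h0 _ _ _ _ _ h
  have h2 := h0 _ _ _ _ _ h1
  have h3 := h0 _ _ _ _ _ h2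
  have h4 := h0 _ _ _ _ _ h3
  intro i
  simp only [mul_assoc]
  fin_cases i
  · exact h
  · exact h1
  · exact h2
  · exact h3
  · exact h4

/-- The primal part of the closure equation. -/
theorem primal_closure (hx : x ∈ L.configSet) : ∃ c : ℂ, c ≠ 0 ∧ ∀ i : Fin 5,
    ((L i).motion (x i)).fst * ((L (i + 1)).motion (x (i + 1))).fst *
      ((L (i + 2)).motion (x (i + 2))).fst * ((L (i + 3)).motion (x (i + 3))).fst *
        ((L (i + 4)).motion (x (i + 4))).fst = c • (1 : ℍ[ℂ]) := by
  obtain ⟨c, hc, h⟩ := closure_rotate hx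
  refine ⟨c, hc, fun i => ?_⟩
  have := congrArg TrivSqZeroExt.fst (h i)
  simpa [Algebra.algebraMap_eq_smul_one] using this

end Linkage

theorem lineChart_injective (c : Bool) : Function.Injective (lineChart c) := by
  intro z w h
  cases c with
  | false => exact OnePoint.coe_injective h
  | true =>
    simp only [lineChart] at h
    split_ifs at h with h1 h2 h2
    · rw [h1, h2]
    · exact (OnePoint.infty_ne_coe _ h).elim
    · exact (OnePoint.coe_ne_infty _ h).elim
    · exact inv_injective (OnePoint.coe_injective h)

/-- The parameter of a moving joint takes infinitely many values in the configuration set. -/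
theorem Linkage.Moves.infinite {n : ℕ} {L : Linkage n} {k : Fin n} (h : L.Moves k) :
    ((fun x => x k) '' L.configSet).Infinite := by
  obtain ⟨c, f, ⟨hf, hK⟩, hne⟩ := h
  intro hfin
  apply hne
  have hcont : ContinuousAt (fun z => f z k) 0 :=
    (continuous_apply k).continuousAt.comp hf.continuousAt
  have hfin' : (lineChart (c k) ⁻¹' ((fun x => x k) '' L.configSet)).Finite :=
    hfin.preimage (lineChart_injective _).injOn
  -- Deleting the finitely many other values leaves a neighbourhood of `f 0 k`, and continuity keeps
  -- `f z k` inside it.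
  have hopen : (lineChart (c k) ⁻¹' ((fun x => x k) '' L.configSet) \ {f 0 k})ᶜ ∈ 𝓝 (f 0 k) :=
    (hfin'.sdiff).isClosed.isOpen_compl.mem_nhds (by simp)
  filter_upwards [hcont hopen, hK] with z hz1 hz2
  by_contra hz3
  exact hz1 ⟨⟨_, hz2, rfl⟩, hz3⟩

/-! ### Composites of rotations about non-parallel axes -/

section Field

variable {k : Type} [Field k] (θ : ℝ →+* k)

theorem normSq_lin_eq {p : ℍ[ℝ]} (hp : p * p = -1) (a b : k) :
    Quaternion.normSq (lin θ p a b) = a ^ 2 + b ^ 2 := by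
  obtain ⟨h0, h1⟩ := re_eq_zero_of_mul_self hp
  have h2 := congrArg θ h1
  simp only [map_add, map_pow, map_one] at h2
  rw [Quaternion.normSq_def']
  simp [lin, h0]
  linear_combination b ^ 2 * h2

theorem quatMap_mul_self {p : ℍ[ℝ]} (hp : p * p = -1) : quatMap θ p * quatMap θ p = -1 := by
  rw [← map_mul, hp, map_neg, map_one]

theorem lin_mul_self {p : ℍ[ℝ]} (hp : p * p = -1) (a b a' b' : k) :
    lin θ p a b * lin θ p a' b' = lin θ p (a * a' - b * b') (a * b' + b * a') := by
  rw [lin_mul_lin, quatMap_mul_self θ hp, lin]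
  module

/-- The left factor in a factorization of a nonzero scalar whose right factor lies in the span of
`1` and `r` lies in that span, too. -/
theorem exists_lin_of_mul_lin {r : ℍ[ℝ]} (hr : r * r = -1) {X : ℍ[k]} {a b c : k} (hc : c ≠ 0)
    (h : X * lin θ r a b = c • (1 : ℍ[k])) : ∃ a' b', X = lin θ r a' b' := by
  have hN : a ^ 2 + b ^ 2 ≠ 0 := by
    intro h0
    have := congrArg Quaternion.normSq h
    rw [map_mul, normSq_lin_eq θ hr, h0, mul_zero, Quaternion.normSq_smul, map_one, mul_one] at this
    exact pow_ne_zero 2 hc this.symm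
  refine ⟨c * (a ^ 2 + b ^ 2)⁻¹ * a, c * (a ^ 2 + b ^ 2)⁻¹ * -b, ?_⟩
  have h1 : X * (lin θ r a b * lin θ r a (-b)) = c • lin θ r a (-b) := by
    rw [← mul_assoc, h, smul_mul_assoc, one_mul]
  rw [lin_mul_self θ hr, show a * a - b * -b = a ^ 2 + b ^ 2 by ring,
    show a * -b + b * a = 0 by ring, lin, zero_smul, sub_zero, mul_smul_comm, mul_one] at h1
  rw [lin_mul_left, mul_comm c, mul_smul, ← h1, inv_smul_smul₀ hN]

/-- Let `p` and `q` be non-parallel. If `(a - b p) (a' - b' q)` is in the span of `1` and `r`, then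
one of the two parameters `(a : b)` and `(a' : b')` can only have finitely many values. -/
theorem spherical_triangle (p q r : ℍ[ℝ]) (hp : p * p = -1) (hq : q * q = -1) (h1 : q ≠ p)
    (h2 : q ≠ -p) :
    (∃ v, ∀ a b a' b' α β : k, (a ≠ 0 ∨ b ≠ 0) → (a' ≠ 0 ∨ b' ≠ 0) →
      lin θ p a b * lin θ q a' b' = lin θ r α β → b = 0 ∨ a = v * b) ∨
    (∀ a b a' b' α β : k, (a ≠ 0 ∨ b ≠ 0) → (a' ≠ 0 ∨ b' ≠ 0) →
      lin θ p a b * lin θ q a' b' = lin θ r α β → b' = 0) := by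
  let e : Fin 4 → ℍ[k] := ![1, quatMap θ p, quatMap θ q, quatMap θ p * quatMap θ q]
  have hli : LinearIndependent k e := by
    rw [Fintype.linearIndependent_iff]
    intro g hg
    simp only [e, Fin.sum_univ_four] at hg
    obtain ⟨g0, g1, g2, g3⟩ := quat_independent θ hp hq h1 h2 hg
    intro i
    fin_cases i
    exacts [g0, g1, g2, g3]
  have hspan := hli.span_eq_top_of_card_eq_finrank (by simp [Quaternion.finrank_eq_four])
  have hmem : quatMap θ r ∈ Submodule.span k (Set.range e) := hspan ▸ Submodule.mem_top
  obtain ⟨g, hg⟩ := (Submodule.mem_span_range_iff_exists_fun k).mp hmem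
  simp only [e, Fin.sum_univ_four] at hg
  replace hg : quatMap θ r = g 0 • (1 : ℍ[k]) + g 1 • quatMap θ p + g 2 • quatMap θ q +
    g 3 • (quatMap θ p * quatMap θ q) := hg.symm
  generalize g 0 = x at hg
  generalize g 1 = y at hg
  generalize g 2 = z at hg
  generalize g 3 = w at hg
  have key : ∀ a b a' b' α β : k, lin θ p a b * lin θ q a' b' = lin θ r α β →
      a * a' = α - β * x ∧ a' * b = β * y ∧ a * b' = β * z ∧ b * b' = - (β * w) := by
    intro a b a' b' α β h
    rw [lin_mul_lin, lin, hg] at h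
    obtain ⟨e0, e1, e2, e3⟩ := quat_independent θ hp hq h1 h2
      (α := a * a' - (α - β * x)) (β := -(a' * b) + β * y) (γ := -(a * b') + β * z)
      (δ := b * b' + β * w) (by rw [← sub_eq_zero] at h; rw [← h]; module)
    refine ⟨?_, ?_, ?_, ?_⟩
    · linear_combination e0
    · linear_combination -e1
    · linear_combination -e2
    · linear_combination e3
  -- Here r = x + yp + zq + wpq. If w ≠ 0, the q- and pq-coefficients fix the ratio a : b = -z : w
  -- unless b = 0. If w = 0, then bb' = 0, and y decides which factor vanishes.
  by_cases hw : w = 0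
  · by_cases hy : y = 0
    · left
      refine ⟨0, fun a b a' b' α β hab hab' h => ?_⟩
      obtain ⟨-, e1, e2, e3⟩ := key _ _ _ _ _ _ h
      grind
    · right
      intro a b a' b' α β hab hab' h
      obtain ⟨-, e1, e2, e3⟩ := key _ _ _ _ _ _ h
      grind
  · left
    refine ⟨-z / w, fun a b a' b' α β hab hab' h => ?_⟩
    obtain ⟨-, e1, e2, e3⟩ := key _ _ _ _ _ _ h
    by_cases hb : b = 0
    · exact Or.inl hb
    · right
      have hb' : b' ≠ 0 := by grind
      field_simp
      refine mul_left_cancel₀ hb' ?_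
      linear_combination w * e2 + z * e3

/-- The motion of an R-joint with homogeneous parameter `(a : b)`. -/
def dualLin (h : DualQuat ℝ) (a b : k) : DualQuat k :=
  DualQuat.mk (lin θ h.fst a b) (-(b • quatMap θ h.snd))

theorem dualQuat_anticomm {h : DualQuat ℝ} (hh : h * h = -1) :
    h.fst * h.fst = -1 ∧ h.fst * h.snd = -(h.snd * h.fst) := by
  have h1 := congrArg TrivSqZeroExt.fst hh
  have h2 := congrArg TrivSqZeroExt.snd hh
  simp at h1 h2
  exact ⟨h1, eq_neg_of_add_eq_zero_left h2⟩

theorem dualLin_mul_conj {h : DualQuat ℝ} (hh : h * h = -1) (a b : k) :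
    dualLin θ h a b * dualLin θ h a (-b) = algebraMap k (DualQuat k) (a ^ 2 + b ^ 2) := by
  obtain ⟨h1, h2⟩ := dualQuat_anticomm hh
  have h2' : quatMap θ h.fst * quatMap θ h.snd = -(quatMap θ h.snd * quatMap θ h.fst) := by
    rw [← map_mul, h2, map_neg, map_mul]
  apply TrivSqZeroExt.ext
  · rw [TrivSqZeroExt.fst_mul, dualLin, dualLin, DualQuat.fst_mk, DualQuat.fst_mk,
      lin_mul_self θ h1, lin, Algebra.algebraMap_eq_smul_one]
    simp only [TrivSqZeroExt.fst_smul, TrivSqZeroExt.fst_one]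
    module
  · rw [TrivSqZeroExt.snd_mul, dualLin, dualLin, DualQuat.fst_mk, DualQuat.fst_mk,
      DualQuat.snd_mk, DualQuat.snd_mk, Algebra.algebraMap_eq_smul_one]
    simp only [TrivSqZeroExt.snd_smul, TrivSqZeroExt.snd_one, lin, smul_eq_mul,
      MulOpposite.smul_eq_mul_unop, MulOpposite.unop_op, sub_mul, mul_sub, neg_mul, mul_neg,
      smul_mul_assoc, mul_smul_comm, one_mul, mul_one, h2']
    module

/-- The last two factors are moved to the right by multiplying with their conjugates. Their norms
are non-zero because the product of all norms is c², and μ is c divided by these two norms. -/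
theorem ClosureEq.of_prod {p : ℍ[ℝ]} {h₂ h₃ h₄ h₅ : DualQuat ℝ} (k₂ : h₂ * h₂ = -1)
    (k₃ : h₃ * h₃ = -1) (k₄ : h₄ * h₄ = -1) (k₅ : h₅ * h₅ = -1)
    {s a₂ b₂ a₃ b₃ a₄ b₄ a₅ b₅ c : k} (hc : c ≠ 0)
    (h : DualQuat.mk 1 (-(s • quatMap θ p)) * dualLin θ h₂ a₂ b₂ * dualLin θ h₃ a₃ b₃ *
      dualLin θ h₄ a₄ b₄ * dualLin θ h₅ a₅ b₅ = algebraMap k (DualQuat k) c) :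
    ∃ μ, ClosureEq θ p h₂.fst h₂.snd h₃.fst h₃.snd h₄.fst h₄.snd h₅.fst h₅.snd
      s μ a₂ b₂ a₃ b₃ a₄ b₄ a₅ b₅ := by
  have hN := congrArg (fun z : DualQuat k => Quaternion.normSq z.fst) h
  simp only [TrivSqZeroExt.fst_mul, dualLin, DualQuat.fst_mk, map_mul, map_one,
    normSq_lin_eq θ (dualQuat_anticomm k₂).1, normSq_lin_eq θ (dualQuat_anticomm k₃).1,
    normSq_lin_eq θ (dualQuat_anticomm k₄).1, normSq_lin_eq θ (dualQuat_anticomm k₅).1,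
    Algebra.algebraMap_eq_smul_one, TrivSqZeroExt.fst_smul, TrivSqZeroExt.fst_one,
    Quaternion.normSq_smul] at hN
  have hN4 : a₄ ^ 2 + b₄ ^ 2 ≠ 0 := by
    intro h0
    rw [h0] at hN
    apply pow_ne_zero 2 hc
    linear_combination -hN
  have hN5 : a₅ ^ 2 + b₅ ^ 2 ≠ 0 := by
    intro h0
    rw [h0] at hN
    apply pow_ne_zero 2 hc
    linear_combination -hN
  have h1 := congrArg (fun z => z * dualLin θ h₅ a₅ (-b₅) * dualLin θ h₄ a₄ (-b₄)) h
  simp only [mul_assoc] at h1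
  rw [← mul_assoc (dualLin θ h₅ a₅ b₅), dualLin_mul_conj θ k₅, Algebra.commutes (a₅ ^ 2 + b₅ ^ 2),
    ← mul_assoc (dualLin θ h₄ a₄ b₄), dualLin_mul_conj θ k₄] at h1
  simp only [Algebra.algebraMap_eq_smul_one, smul_mul_assoc, mul_smul_comm, one_mul, mul_one,
    smul_smul] at h1
  have h2 := congrArg (fun z => ((a₄ ^ 2 + b₄ ^ 2) * (a₅ ^ 2 + b₅ ^ 2))⁻¹ • z) h1
  simp only [smul_smul] at h2
  rw [show ((a₄ ^ 2 + b₄ ^ 2) * (a₅ ^ 2 + b₅ ^ 2))⁻¹ * ((a₅ ^ 2 + b₅ ^ 2) * (a₄ ^ 2 + b₄ ^ 2)) = 1 by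
    field_simp, one_smul] at h2
  refine ⟨((a₄ ^ 2 + b₄ ^ 2) * (a₅ ^ 2 + b₅ ^ 2))⁻¹ * c, ?_, ?_⟩
  · have := congrArg TrivSqZeroExt.fst h2
    simpa [dualLin] using this
  · have := congrArg TrivSqZeroExt.snd h2
    simp only [dualLin, TrivSqZeroExt.snd_mul, TrivSqZeroExt.fst_mul, TrivSqZeroExt.snd_smul,
      DualQuat.fst_mk, DualQuat.snd_mk, smul_eq_mul,
      MulOpposite.smul_eq_mul_unop, MulOpposite.unop_op, one_mul] at this
    simp only [linDual]
    convert this using 1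
    · simp only [neg_mul, mul_neg, smul_mul_assoc, mul_smul_comm]
      abel
    · congr 1
      simp only [neg_mul, mul_neg, smul_mul_assoc, mul_smul_comm]
      module

end Field

/-! ### Parallel joints -/

theorem lin_neg_dir {R : Type*} [CommRing R] (θ : ℝ →+* R) (p : ℍ[ℝ]) (a b : R) :
    lin θ (-p) a b = lin θ p a (-b) := by
  simp only [lin, map_neg, smul_neg, neg_smul]

namespace Joint

theorem IsR.exists_eq {j : Joint} (h : j.IsR) : ∃ a sq, j = R a sq := by
  cases j with
  | R a sq => exact ⟨a, sq, rfl⟩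
  | P => exact h.elim

theorem IsP.exists_eq {j : Joint} (h : j.IsP) : ∃ p sq, j = P p sq := by
  cases j with
  | R => exact h.elim
  | P a sq => exact ⟨a, sq, rfl⟩

theorem isR_of_not_isP {j : Joint} (h : ¬ j.IsP) : j.IsR := by
  cases j with
  | R => trivial
  | P => exact (h trivial).elim

theorem not_isP_of_isR {j : Joint} (h : j.IsR) : ¬ j.IsP := by
  cases j with
  | R => exact id
  | P => exact h.elim

theorem fst_motion_of_isP {j : Joint} (h : j.IsP) (x : OnePoint ℂ) : (j.motion x).fst = 1 := by
  rw [fst_motion, den_of_isP h]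
  cases j with
  | R => exact h.elim
  | P => simp [lin, num]

theorem Parallel.symm {j j' : Joint} (h : j.Parallel j') : j'.Parallel j := by
  rcases h with h | h
  · exact Or.inl h.symm
  · exact Or.inr (by rw [h, neg_neg])

theorem Parallel.trans {j j' j'' : Joint} (h : j.Parallel j') (h' : j'.Parallel j'') :
    j.Parallel j'' := by
  rcases h with h | h <;> rcases h' with h' | h' <;> rw [h] at h'
  · exact Or.inl h'
  · exact Or.inr h'
  · exact Or.inr h'
  · exact Or.inl (by rw [h', neg_neg])

theorem Parallel.refl (j : Joint) : j.Parallel j := Or.inl rfl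

/-- The composition of two rotations about parallel axes is a rotation about an axis in the same
direction. -/
theorem Parallel.exists_lin {j j' : Joint} (h : j.Parallel j') (x y : OnePoint ℂ) :
    ∃ a b, (j.motion x).fst * (j'.motion y).fst = lin Complex.ofRealHom j.dir a b := by
  rw [fst_motion, fst_motion]
  rcases h with h | h
  · rw [h, lin_mul_self _ j.dir_mul_dir]
    exact ⟨_, _, rfl⟩
  · rw [h, lin_neg_dir, lin_mul_self _ j.dir_mul_dir]
    exact ⟨_, _, rfl⟩

end Joint

namespace Linkage

/-- Only the values `∞` and `v` remain, whereas a moving parameter takes infinitely many. -/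
theorem not_moves_of_ratio {n : ℕ} {L : Linkage n} {k : Fin n} (hk : (L k).IsR) (v : ℂ)
    (h : ∀ x ∈ L.configSet, (L k).den (x k) = 0 ∨ (L k).num (x k) = v * (L k).den (x k)) :
    ¬ L.Moves k := by
  intro hm
  apply hm.infinite
  obtain ⟨a, sq, hL⟩ := hk.exists_eq
  refine Set.Finite.subset (s := {OnePoint.infty, (v : OnePoint ℂ)}) (by simp) ?_
  rintro _ ⟨x, hx, rfl⟩
  have := h x hx
  rw [hL] at this
  simp only [Joint.num, Joint.den] at this
  change x k ∈ _
  generalize x k = y at this ⊢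
  induction y using OnePoint.rec with
  | infty => simp
  | coe t =>
    simp at this
    simp [this]

/-- Two moving R-joints are parallel if the composition of the two rotations always is a rotation
about an axis in a fixed direction. -/
theorem parallel_of_mul_eq_lin {n : ℕ} {L : Linkage n} {k l : Fin n} (hk : (L k).IsR)
    (hl : (L l).IsR) (mk : L.Moves k) (ml : L.Moves l) (r : ℍ[ℝ])
    (h : ∀ x ∈ L.configSet, ∃ a b : ℂ, ((L k).motion (x k)).fst * ((L l).motion (x l)).fst =
      lin Complex.ofRealHom r a b) : (L k).Parallel (L l) := by
  by_contra hp
  simp only [Joint.Parallel, not_or] at hp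
  rcases spherical_triangle Complex.ofRealHom _ _ r (L k).dir_mul_dir (L l).dir_mul_dir hp.1 hp.2
    with ⟨v, hv⟩ | hv
  · refine not_moves_of_ratio hk v (fun x hx => ?_) mk
    obtain ⟨a, b, hab⟩ := h x hx
    rw [Joint.fst_motion, Joint.fst_motion] at hab
    exact hv _ _ _ _ _ _ (Joint.num_or_den_ne_zero _ _) (Joint.num_or_den_ne_zero _ _) hab
  · refine not_moves_of_ratio hl 0 (fun x hx => Or.inl ?_) ml
    obtain ⟨a, b, hab⟩ := h x hx
    rw [Joint.fst_motion, Joint.fst_motion] at hab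
    exact hv _ _ _ _ _ _ (Joint.num_or_den_ne_zero _ _) (Joint.num_or_den_ne_zero _ _) hab

end Linkage

/-! ### Two or more P-joints -/

theorem mul_mul_of_lt {M : Type*} [Monoid M] {l n : Fin 5} (hl : l ≠ 0) (h : l < n)
    {G : Fin 5 → M} {c : M} (hG : ∀ j, j ≠ 0 → j ≠ l → j ≠ n → G j = 1)
    (e : G 0 * G 1 * G 2 * G 3 * G 4 = c) : G 0 * G l * G n = c := by
  have g1 := hG 1
  have g2 := hG 2
  have g3 := hG 3
  have g4 := hG 4
  clear hG
  fin_cases l <;> fin_cases n <;> first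
    | exact absurd h (by decide)
    | exact absurd rfl hl
    | (simp at g1 g2 g3 g4
       simp only [g1, g2, g3, g4, mul_one] at e
       exact e)

theorem mul_mul_of_gt {M : Type*} [Monoid M] {l n : Fin 5} (hn : n ≠ 0) (h : n < l)
    {G : Fin 5 → M} {c : M} (hG : ∀ j, j ≠ 0 → j ≠ l → j ≠ n → G j = 1)
    (e : G l * G (l + 1) * G (l + 2) * G (l + 3) * G (l + 4) = c) : G l * G 0 * G n = c := by
  have g1 := hG 1
  have g2 := hG 2
  have g3 := hG 3
  have g4 := hG 4
  clear hG
  fin_cases l <;> fin_cases n <;> first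
    | exact absurd h (by decide)
    | exact absurd rfl hn
    | (simp at g1 g2 g3 g4
       simp [g1, g2, g3, g4] at e
       exact e)

/-- The R-joints in question are `0` and `l`, and `u`, `v` are P-joints with primal part `1`. The
fifth index `n` lies after or before `l`; starting the cyclic product at `0` or at `l`,
respectively, puts `n` last and brings the two R-joints together. -/
theorem cyclic_triple (M : Type*) [Monoid M] (l u v : Fin 5) (hl : l ≠ 0) (hu : u ≠ 0) (hv : v ≠ 0)
    (hul : u ≠ l) (hvl : v ≠ l) (huv : u ≠ v) :
    (∃ n, ∀ (G : Fin 5 → M) (c : M),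
      (∀ i, G i * G (i + 1) * G (i + 2) * G (i + 3) * G (i + 4) = c) → G u = 1 → G v = 1 →
        G 0 * G l * G n = c) ∨
    (∃ n, ∀ (G : Fin 5 → M) (c : M),
      (∀ i, G i * G (i + 1) * G (i + 2) * G (i + 3) * G (i + 4) = c) → G u = 1 → G v = 1 →
        G l * G 0 * G n = c) := by
  obtain ⟨n, hn, hnl, hnu, hnv⟩ : ∃ n : Fin 5, n ≠ 0 ∧ n ≠ l ∧ n ≠ u ∧ n ≠ v := by
    revert l u v; decide
  have hG : ∀ G : Fin 5 → M, G u = 1 → G v = 1 → ∀ j, j ≠ 0 → j ≠ l → j ≠ n → G j = 1 := by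
    intro G h1 h2 j h3 h4 h5
    obtain rfl | rfl : j = u ∨ j = v := by omega
    exacts [h1, h2]
  rcases lt_or_gt_of_ne hnl with hlt | hlt
  · exact Or.inr ⟨n, fun G c h h1 h2 => mul_mul_of_gt hn hlt (hG G h1 h2) (h l)⟩
  · exact Or.inl ⟨n, fun G c h h1 h2 => mul_mul_of_lt hl hlt (hG G h1 h2) (by simpa using h 0)⟩

namespace Linkage

variable {L : Linkage 5}

/-- If there are two P-joints, then all axes of R-joints are parallel. -/
theorem parallel_of_two_isP (hmov : ∀ k, L.Moves k) {u v : Fin 5} (huv : u ≠ v) (hu : (L u).IsP)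
    (hv : (L v).IsP) {k l : Fin 5} (hk : (L k).IsR) (hl : (L l).IsR) : (L k).Parallel (L l) := by
  by_cases hkl : l = k
  · rw [hkl]; exact Joint.Parallel.refl _
  have hne : ∀ a b : Fin 5, (L a).IsP → (L b).IsR → a ≠ b := by
    rintro a _ ha hb rfl
    exact Joint.not_isP_of_isR hb ha
  have step : ∀ {a b n : Fin 5}, (L a).IsR → (L b).IsR →
      (∀ x ∈ L.configSet, ∃ c : ℂ, c ≠ 0 ∧ ((L a).motion (x a)).fst * ((L b).motion (x b)).fst *
        ((L n).motion (x n)).fst = c • (1 : ℍ[ℂ])) → (L a).Parallel (L b) := by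
    intro a b n ha hb h
    -- The joint `n` may be prismatic as well: its primal part `1` lies in the span of `1` and any
    -- direction.
    refine parallel_of_mul_eq_lin ha hb (hmov a) (hmov b) (L n).dir fun x hx => ?_
    obtain ⟨c, hc, e⟩ := h x hx
    rw [(L n).fst_motion] at e
    exact exists_lin_of_mul_lin _ (L n).dir_mul_dir hc e
  have main := cyclic_triple ℍ[ℂ] (l - k) (u - k) (v - k) (sub_ne_zero.mpr hkl)
    (sub_ne_zero.mpr (hne _ _ hu hk)) (sub_ne_zero.mpr (hne _ _ hv hk))
    (fun h => hne _ _ hu hl (sub_left_injective h)) (fun h => hne _ _ hv hl (sub_left_injective h))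
    (fun h => huv (sub_left_injective h))
  have hcl : ∀ x ∈ L.configSet, ∃ c : ℂ, c ≠ 0 ∧ ∀ i : Fin 5,
      ((L (k + i)).motion (x (k + i))).fst * ((L (k + (i + 1))).motion (x (k + (i + 1)))).fst *
      ((L (k + (i + 2))).motion (x (k + (i + 2)))).fst *
      ((L (k + (i + 3))).motion (x (k + (i + 3)))).fst *
      ((L (k + (i + 4))).motion (x (k + (i + 4)))).fst = c • (1 : ℍ[ℂ]) := by
    intro x hx
    obtain ⟨c, hc, h⟩ := primal_closure hx
    refine ⟨c, hc, fun i => ?_⟩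
    simp only [← add_assoc]
    exact h (k + i)
  have e0 : ∀ a, k + (a - k) = a := fun a => add_sub_cancel k a
  rcases main with ⟨n, hn⟩ | ⟨n, hn⟩
  · refine step (n := k + n) hk hl fun x hx => ?_
    obtain ⟨c, hc, h⟩ := hcl x hx
    have := hn (fun i => ((L (k + i)).motion (x (k + i))).fst) _ h
      (by rw [e0]; exact Joint.fst_motion_of_isP hu _)
      (by rw [e0]; exact Joint.fst_motion_of_isP hv _)
    rw [e0, add_zero] at this
    exact ⟨c, hc, this⟩
  · refine (step (n := k + n) hl hk fun x hx => ?_).symm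
    obtain ⟨c, hc, h⟩ := hcl x hx
    have := hn (fun i => ((L (k + i)).motion (x (k + i))).fst) _ h
      (by rw [e0]; exact Joint.fst_motion_of_isP hu _)
      (by rw [e0]; exact Joint.fst_motion_of_isP hv _)
    rw [e0, add_zero] at this
    exact ⟨c, hc, this⟩

/-! ### A single P-joint: two parallel pairs -/

theorem motion_R_eq_dualLin (h : DualQuat ℝ) (sq : h * h = -1) (x : OnePoint ℂ) :
    (Joint.R h sq).motion x = dualLin Complex.ofRealHom h (lineNum x) (lineDen x) := by
  apply TrivSqZeroExt.ext
  · rw [Joint.fst_motion_R, dualLin, DualQuat.fst_mk]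
  · rw [Joint.snd_motion_R, dualLin, DualQuat.snd_mk]

theorem motion_P_coe (p : ℍ[ℝ]) (sq : p * p = -1) (s : ℂ) :
    (Joint.P p sq).motion (s : OnePoint ℂ) =
      DualQuat.mk 1 (-(s • quatMap Complex.ofRealHom p)) := by
  apply TrivSqZeroExt.ext <;> simp [Joint.motion, complexifyQuat_eq]

/-- A P-joint moves only if, among the other four joints, the first two or the last two have
parallel axes. -/
theorem parallel_or_parallel {i : Fin 5} (hi : (L i).IsP) (h₂ : (L (i + 1)).IsR)
    (h₃ : (L (i + 2)).IsR) (h₄ : (L (i + 3)).IsR) (h₅ : (L (i + 4)).IsR) (hmov : L.Moves i) :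
    (L (i + 1)).Parallel (L (i + 2)) ∨ (L (i + 3)).Parallel (L (i + 4)) := by
  by_contra! hcon
  obtain ⟨hp, hp'⟩ := hcon
  obtain ⟨p, sq, hL⟩ := hi.exists_eq
  obtain ⟨a₂, sq₂, hL₂⟩ := h₂.exists_eq
  obtain ⟨a₃, sq₃, hL₃⟩ := h₃.exists_eq
  obtain ⟨a₄, sq₄, hL₄⟩ := h₄.exists_eq
  obtain ⟨a₅, sq₅, hL₅⟩ := h₅.exists_eq
  rw [hL₂, hL₃] at hp
  rw [hL₄, hL₅] at hp'
  simp only [Joint.Parallel, Joint.dir, not_or] at hp hp'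
  have hfin := ClosureEq.finite (q₂ := a₂.snd) (q₃ := a₃.snd) (q₄ := a₄.snd) (q₅ := a₅.snd) sq
    (dualQuat_anticomm sq₂).1 (dualQuat_anticomm sq₃).1
    (dualQuat_anticomm sq₄).1 (dualQuat_anticomm sq₅).1 hp.1 hp.2 (Ne.symm hp'.1)
    (fun h => hp'.2 (by rw [h, neg_neg]))
  apply hmov.infinite
  refine (hfin.image ((↑) : ℂ → OnePoint ℂ)).subset ?_
  rintro _ ⟨x, hx, rfl⟩
  obtain ⟨c, hc, h⟩ := closure_rotate hx
  have hpar := hx.1 i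
  specialize h i
  rw [hL] at h hpar
  obtain ⟨s, hs⟩ := OnePoint.ne_infty_iff_exists.mp hpar
  simp only at hs ⊢
  rw [← hs, hL₂, hL₃, hL₄, hL₅, motion_P_coe] at h
  simp only [motion_R_eq_dualLin] at h
  obtain ⟨μ, hμ⟩ := ClosureEq.of_prod Complex.ofRealHom sq₂ sq₃ sq₄ sq₅ hc h
  exact ⟨s, ⟨μ, _, _, _, _, _, _, _, _, hμ, lineNum_or_lineDen_ne_zero _,
    lineNum_or_lineDen_ne_zero _, lineNum_or_lineDen_ne_zero _, lineNum_or_lineDen_ne_zero _⟩, hs⟩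

/-- The primal part of the closure equation of a linkage with the P-joint `i`. -/
theorem primal_closure_of_isP {i : Fin 5} (hi : (L i).IsP) {x : Fin 5 → OnePoint ℂ}
    (hx : x ∈ L.configSet) : ∃ c : ℂ, c ≠ 0 ∧
      ((L (i + 1)).motion (x (i + 1))).fst * ((L (i + 2)).motion (x (i + 2))).fst *
        (((L (i + 3)).motion (x (i + 3))).fst * ((L (i + 4)).motion (x (i + 4))).fst) =
          c • (1 : ℍ[ℂ]) ∧
      ((L (i + 3)).motion (x (i + 3))).fst * ((L (i + 4)).motion (x (i + 4))).fst *
        (((L (i + 1)).motion (x (i + 1))).fst * ((L (i + 2)).motion (x (i + 2))).fst) =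
          c • (1 : ℍ[ℂ]) := by
  obtain ⟨c, hc, h⟩ := primal_closure hx
  refine ⟨c, hc, ?_, ?_⟩
  · have := h i
    rw [Joint.fst_motion_of_isP hi, one_mul] at this
    rw [← this, mul_assoc, mul_assoc, mul_assoc]
  · have := h (i + 3)
    have e : ∀ j : Fin 5, j + 3 + 1 = j + 4 ∧ j + 3 + 2 = j ∧ j + 3 + 3 = j + 1 ∧
      j + 3 + 4 = j + 2 := by decide
    rw [(e i).1, (e i).2.1, (e i).2.2.1, (e i).2.2.2, Joint.fst_motion_of_isP hi, mul_one] at this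
    rw [← this, mul_assoc, mul_assoc, mul_assoc]

theorem parallel_and_parallel {i : Fin 5} (hi : (L i).IsP) (h₂ : (L (i + 1)).IsR)
    (h₃ : (L (i + 2)).IsR) (h₄ : (L (i + 3)).IsR) (h₅ : (L (i + 4)).IsR)
    (hmov : ∀ k, L.Moves k) :
    (L (i + 1)).Parallel (L (i + 2)) ∧ (L (i + 3)).Parallel (L (i + 4)) := by
  -- Parallel axes compose to an element of the span of `1` and their direction, and the other pair
  -- is its inverse up to a scalar, so lies in the same span.
  have h23 : (L (i + 1)).Parallel (L (i + 2)) → (L (i + 3)).Parallel (L (i + 4)) := by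
    intro hp
    refine parallel_of_mul_eq_lin h₄ h₅ (hmov _) (hmov _) (L (i + 1)).dir fun x hx => ?_
    obtain ⟨c, hc, -, e⟩ := primal_closure_of_isP hi hx
    obtain ⟨a, b, hab⟩ := hp.exists_lin (x (i + 1)) (x (i + 2))
    rw [hab] at e
    exact exists_lin_of_mul_lin _ (L (i + 1)).dir_mul_dir hc e
  have h45 : (L (i + 3)).Parallel (L (i + 4)) → (L (i + 1)).Parallel (L (i + 2)) := by
    intro hp
    refine parallel_of_mul_eq_lin h₂ h₃ (hmov _) (hmov _) (L (i + 3)).dir fun x hx => ?_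
    obtain ⟨c, hc, e, -⟩ := primal_closure_of_isP hi hx
    obtain ⟨a, b, hab⟩ := hp.exists_lin (x (i + 3)) (x (i + 4))
    rw [hab] at e
    exact exists_lin_of_mul_lin _ (L (i + 3)).dir_mul_dir hc e
  rcases parallel_or_parallel hi h₂ h₃ h₄ h₅ (hmov i) with h | h
  · exact ⟨h, h23 h⟩
  · exact ⟨h45 h, h⟩

end Linkage

/-! ### Circular translations -/

section Field

variable {k : Type} [Field k] (θ : ℝ →+* k)

theorem normSq_quatMap (q : ℍ[ℝ]) :
    Quaternion.normSq (quatMap θ q) = θ (Quaternion.normSq q) := by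
  simp [Quaternion.normSq_def']

/-- The translation vector of the circular translation `(a - b h) (a' - b' h')` with parallel axes
`h`, `h'`, direction `p` and `d` measuring the distance of the axes. -/
def circ (p d : ℍ[ℝ]) (a b : k) : ℍ[k] := (b / (a ^ 2 + b ^ 2)) • (lin θ p a b * quatMap θ d)

theorem circ_mul_left (p d : ℍ[ℝ]) {r : k} (hr : r ≠ 0) (a b : k) :
    circ θ p d (r * a) (r * b) = circ θ p d a b := by
  rw [circ, circ, lin_mul_left, smul_mul_assoc, smul_smul]
  congr 1
  -- In the isotropic case both sides are zero, because division by zero gives zero.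
  by_cases h : a ^ 2 + b ^ 2 = 0
  · rw [show (r * a) ^ 2 + (r * b) ^ 2 = r ^ 2 * (a ^ 2 + b ^ 2) by ring, h]
    simp
  · rw [show (r * a) ^ 2 + (r * b) ^ 2 = r ^ 2 * (a ^ 2 + b ^ 2) by ring]
    field_simp

theorem circ_apply (ℓ : ℍ[k] →ₗ[k] k) (p d : ℍ[ℝ]) (a b : k) :
    ℓ (circ θ p d a b) = b / (a ^ 2 + b ^ 2) *
      (a * ℓ (quatMap θ d) - b * ℓ (quatMap θ p * quatMap θ d)) := by
  simp only [circ, lin, sub_mul, smul_mul_assoc, one_mul, map_smul, map_sub, smul_eq_mul]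

/-- The hypotheses encode t' = -ρt. The primal parts are then conjugate up to a scalar, and since q
anticommutes with p, moving q past a + bp turns it into a - bp; so the dual part collects into (a -
bp)(ρq' - q). -/
theorem dualLin_mul_dualLin {h h' : DualQuat ℝ} (hh : h * h = -1) {ρ : ℝ} (hρ : ρ ^ 2 = 1)
    (hp : h'.fst = ρ • h.fst) {a b a' b' τ : k} (ha : a' = -(τ * θ ρ * a)) (hb : b' = τ * b)
    (hN : a ^ 2 + b ^ 2 ≠ 0) :
    dualLin θ h a b * dualLin θ h' a' b' = (-(τ * θ ρ) * (a ^ 2 + b ^ 2)) •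
      DualQuat.mk 1 (circ θ h.fst (ρ • h'.snd - h.snd) a b) := by
  obtain ⟨h1, h2⟩ := dualQuat_anticomm hh
  have h2' : quatMap θ h.fst * quatMap θ h.snd = -(quatMap θ h.snd * quatMap θ h.fst) := by
    rw [← map_mul, h2, map_neg, map_mul]
  have hρ' : θ ρ ^ 2 = 1 := by rw [← map_pow, hρ, map_one]
  subst ha hb
  have hl : lin θ h'.fst (-(τ * θ ρ * a)) (τ * b) = (-(τ * θ ρ)) • lin θ h.fst a (-b) := by
    rw [hp, lin, lin, quatMap_smul, smul_sub, smul_smul, smul_smul, smul_smul]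
    congr 2 <;> ring
  apply TrivSqZeroExt.ext
  · simp only [TrivSqZeroExt.fst_mul, TrivSqZeroExt.fst_smul, dualLin, DualQuat.fst_mk]
    rw [hl, mul_smul_comm, lin_mul_self θ h1, lin]
    module
  · simp only [TrivSqZeroExt.snd_mul, TrivSqZeroExt.snd_smul, dualLin, DualQuat.fst_mk,
      DualQuat.snd_mk, smul_eq_mul, MulOpposite.smul_eq_mul_unop, MulOpposite.unop_op]
    have hq : quatMap θ h.snd * lin θ h.fst a (-b) = lin θ h.fst a b * quatMap θ h.snd := by
      simp only [lin, sub_mul, mul_sub, smul_mul_assoc, mul_smul_comm, one_mul, mul_one, h2']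
      module
    rw [hl, circ, smul_smul, mul_assoc, mul_div_cancel₀ b hN, map_sub, quatMap_smul]
    simp only [neg_mul, mul_neg, smul_mul_assoc, mul_smul_comm, hq, mul_sub, smul_sub, smul_smul]
    rw [show τ * θ ρ * b * θ ρ = τ * b by linear_combination τ * b * hρ']
    module

/-- Otherwise d = αP and pd = βP, so (β - αp)d = 0. A real d ≠ 0 stays invertible over `k`, hence β
= αp. This is impossible, since α ≠ 0 and p is non-zero with real part zero. The functional will
eliminate the prismatic parameter while keeping a circular translation visible. -/
theorem exists_functional {p d : ℍ[ℝ]} (hp : p * p = -1) (hd : d ≠ 0) (P : ℍ[k]) :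
    ∃ ℓ : ℍ[k] →ₗ[k] k, ℓ P = 0 ∧ (ℓ (quatMap θ d) ≠ 0 ∨ ℓ (quatMap θ p * quatMap θ d) ≠ 0) := by
  by_contra! hcon
  have hspan : ∀ v : ℍ[k], (∀ ℓ : ℍ[k] →ₗ[k] k, ℓ P = 0 → ℓ v = 0) → ∃ r : k, r • P = v := by
    intro v hv
    by_contra hn
    rw [← Submodule.mem_span_singleton] at hn
    obtain ⟨ℓ, h1, h2⟩ := Submodule.exists_le_ker_of_notMem hn
    exact h1 (hv ℓ (h2 (Submodule.mem_span_singleton_self P)))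
  obtain ⟨α, hα⟩ := hspan _ fun ℓ h => (hcon ℓ h).1
  obtain ⟨β, hβ⟩ := hspan _ fun ℓ h => (hcon ℓ h).2
  have hN : Quaternion.normSq (quatMap θ d) ≠ 0 := by
    rw [normSq_quatMap]
    exact (map_ne_zero θ).mpr (Quaternion.normSq_ne_zero.mpr hd)
  have h1 : lin θ p β α * quatMap θ d = 0 := by
    rw [lin, sub_mul, smul_mul_assoc, smul_mul_assoc, ← hβ, one_mul, ← hα, smul_smul, smul_smul,
      mul_comm, sub_self]
  have h3 : α ≠ 0 := by
    rintro rfl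
    rw [zero_smul] at hα
    rw [← hα] at hN
    simp at hN
  obtain ⟨h4, h5⟩ := re_eq_zero_of_mul_self hp
  have h6 : lin θ p β α = 0 := by
    have := congrArg (fun q => q * star (quatMap θ d)) h1
    simp only [mul_assoc, Quaternion.self_mul_star, zero_mul, Quaternion.mul_coe_eq_smul] at this
    exact (smul_eq_zero.mp this).resolve_left hN
  have h7 : β = 0 := by
    have := congrArg (fun q : ℍ[k] => q.re) h6
    simpa [lin, h4] using this
  have h8 : quatMap θ p = 0 := by
    rw [lin, h7, zero_smul, zero_sub, neg_eq_zero] at h6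
    exact (smul_eq_zero.mp h6).resolve_left h3
  have h9 := quatMap_mul_self θ hp
  rw [h8, zero_mul] at h9
  exact one_ne_zero (neg_eq_zero.mp h9.symm)

/-- Translations compose additively as ε² = 0, and the primal part identifies the common factor as
`c`, which can be cancelled. -/
theorem smul_eq_circ_add_circ {P : ℍ[k]} {V V' : ℍ[k]} {s σ σ' c : k} (hc : c ≠ 0)
    (h : DualQuat.mk 1 (-(s • P)) * (σ • DualQuat.mk 1 V) * (σ' • DualQuat.mk 1 V') =
      algebraMap k (DualQuat k) c) : s • P = V + V' := by
  have h1 := congrArg TrivSqZeroExt.fst h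
  have h2 := congrArg TrivSqZeroExt.snd h
  simp only [TrivSqZeroExt.snd_mul, TrivSqZeroExt.snd_smul, TrivSqZeroExt.fst_mul,
    TrivSqZeroExt.fst_smul, DualQuat.fst_mk,
      DualQuat.snd_mk, smul_eq_mul, MulOpposite.smul_eq_mul_unop, MulOpposite.unop_op,
      Algebra.algebraMap_eq_smul_one, TrivSqZeroExt.fst_one, TrivSqZeroExt.snd_one,
      mul_smul_comm, smul_mul_assoc, one_mul, mul_one, smul_zero] at h1 h2
  have h3 : σ' * σ = c := by
    have := congrArg (fun q : ℍ[k] => q.re) h1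
    simpa using this
  have h4 : (σ' * σ) • (V + V' - s • P) = 0 := by
    rw [← h2]
    module
  rw [h3] at h4
  exact (sub_eq_zero.mp ((smul_eq_zero.mp h4).resolve_left hc)).symm

end Field

/-! ### Affine charts of the parameter lines -/

/-- The numerator of a point of the projective line that is given in an affine chart. -/
def chartNum : Bool → ℂ → ℂ
  | false, z => z
  | true, _ => 1

/-- The denominator of a point of the projective line that is given in an affine chart. -/
def chartDen : Bool → ℂ → ℂ
  | false, _ => 1
  | true, z => z

/-- The coordinates (z : 1) and (1 : z) are analytic in z, unlike the normalised `lineNum` and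
`lineDen`. Rescaling does not affect `circ`, which is homogeneous of degree zero. -/
theorem lineNum_lineChart (c : Bool) (z : ℂ) : ∃ r : ℂ, r ≠ 0 ∧
    chartNum c z = r * lineNum (lineChart c z) ∧ chartDen c z = r * lineDen (lineChart c z) := by
  cases c with
  | false => exact ⟨1, one_ne_zero, by simp [chartNum, lineChart], by simp [chartDen, lineChart]⟩
  | true =>
    by_cases hz : z = 0
    · exact ⟨1, one_ne_zero, by simp [chartNum, lineChart, hz], by simp [chartDen, lineChart, hz]⟩
    · exact ⟨z, hz, by simp [chartNum, lineChart, hz], by simp [chartDen, lineChart, hz]⟩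

/-- The change of charts of the projective line. -/
def chartChange (c c' : Bool) (w : ℂ) : ℂ := if c = c' then w else w⁻¹

theorem chartChange_self (c : Bool) : chartChange c c = fun w => w := by
  funext w
  exact if_pos rfl

theorem chartChange_of_ne {c c' : Bool} (h : c ≠ c') : chartChange c c' = fun w => w⁻¹ := by
  funext w
  exact if_neg h

/-- A point lying in two different charts is neither 0 nor ∞, so the transition map, inversion, is
differentiable there. -/
theorem eq_chartChange {c c' : Bool} {w w' : ℂ} (h : lineChart c w = lineChart c' w') :
    w' = chartChange c c' w ∧ DifferentiableAt ℂ (chartChange c c') w := by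
  by_cases hc : c = c'
  · subst hc
    rw [chartChange_self]
    exact ⟨(lineChart_injective c h).symm, differentiableAt_id⟩
  · rw [chartChange_of_ne hc]
    suffices w ≠ 0 ∧ w' = w⁻¹ from ⟨this.2, differentiableAt_inv this.1⟩
    cases c <;> cases c' <;> simp only [lineChart] at h hc
    · exact (hc trivial).elim
    · split_ifs at h with h0
      · exact (OnePoint.coe_ne_infty _ h).elim
      · have e := OnePoint.coe_injective h
        exact ⟨by rw [e]; exact inv_ne_zero h0, by rw [e, inv_inv]⟩
    · split_ifs at h with h0
      · exact (OnePoint.infty_ne_coe _ h).elim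
      · exact ⟨h0, (OnePoint.coe_injective h).symm⟩
    · exact (hc trivial).elim

theorem lineNeg_lineChart (c : Bool) (z : ℂ) : lineNeg (lineChart c z) = lineChart c (-z) := by
  cases c with
  | false => rfl
  | true =>
    by_cases hz : z = 0
    · simp [lineChart, hz, lineNeg]
    · simp [lineChart, hz, lineNeg, inv_neg]

/-- A linear functional of the translation vector of a circular translation, in an affine chart. -/
def circChart (c : Bool) (A B z : ℂ) : ℂ :=
  chartDen c z / (chartNum c z ^ 2 + chartDen c z ^ 2) * (chartNum c z * A - chartDen c z * B)

theorem differentiableAt_circChart (c : Bool) (A B : ℂ) {z : ℂ}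
    (h : chartNum c z ^ 2 + chartDen c z ^ 2 ≠ 0) : DifferentiableAt ℂ (circChart c A B) z := by
  have h1 : DifferentiableAt ℂ (chartNum c) z := by
    cases c
    · exact differentiableAt_id
    · exact differentiableAt_const 1
  have h2 : DifferentiableAt ℂ (chartDen c) z := by
    cases c
    · exact differentiableAt_const 1
    · exact differentiableAt_id
  exact (h2.div ((h1.pow 2).add (h2.pow 2)) h).mul ((h1.mul_const A).sub (h2.mul_const B))

/-- The second difference at a, a ± η isolates γ, then a first difference isolates β. -/
theorem quadratic_eq_zero {α β γ a : ℂ} (h : ∀ᶠ z in 𝓝 a, α + β * z + γ * z ^ 2 = 0) :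
    α = 0 ∧ β = 0 ∧ γ = 0 := by
  obtain ⟨r, hr, hball⟩ := Metric.eventually_nhds_iff.mp h
  have hη : ((r / 2 : ℝ) : ℂ) ≠ 0 := by
    rw [Complex.ofReal_ne_zero]; positivity
  have hn : ‖((r / 2 : ℝ) : ℂ)‖ < r := by
    rw [Complex.norm_real, Real.norm_of_nonneg (by positivity)]; linarith
  generalize ((r / 2 : ℝ) : ℂ) = η at hη hn
  have e0 := hball (y := a) (by simpa using hr)
  have e1 := hball (y := a + η) (by simpa using hn)
  have e2 := hball (y := a - η) (by simpa using hn)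
  have hγ : γ = 0 := by
    have : γ * η ^ 2 = 0 := by linear_combination (e1 + e2 - 2 * e0) / 2
    exact (mul_eq_zero.mp this).resolve_right (pow_ne_zero 2 hη)
  subst hγ
  have hβ : β = 0 := by
    have : β * η = 0 := by linear_combination e1 - e0
    exact (mul_eq_zero.mp this).resolve_right hη
  subst hβ
  exact ⟨by linear_combination e0, rfl, rfl⟩

/-- Clearing the denominator turns constancy into a vanishing quadratic polynomial, whose
coefficients give A = κ = 0 and then B = 0. -/
theorem circChart_not_const {c : Bool} {A B κ a : ℂ} (h : ∀ᶠ z in 𝓝 a,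
    chartNum c z ^ 2 + chartDen c z ^ 2 ≠ 0 ∧ circChart c A B z = κ) : A = 0 ∧ B = 0 := by
  cases c with
  | false =>
    have := quadratic_eq_zero (α := -B - κ) (β := A) (γ := -κ) (a := a) (by
      filter_upwards [h] with z ⟨h1, h2⟩
      simp only [circChart, chartNum, chartDen] at h1 h2
      rw [div_mul_eq_mul_div, div_eq_iff h1] at h2
      linear_combination h2)
    refine ⟨this.2.1, ?_⟩
    linear_combination -this.1 + this.2.2
  | true =>
    have := quadratic_eq_zero (α := -κ) (β := A) (γ := -B - κ) (a := a) (by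
      filter_upwards [h] with z ⟨h1, h2⟩
      simp only [circChart, chartNum, chartDen] at h1 h2
      rw [div_mul_eq_mul_div, div_eq_iff h1] at h2
      linear_combination h2)
    refine ⟨this.2.1, ?_⟩
    linear_combination this.1 - this.2.2

/-- The equation says t' = -ρt. The factor τ compensates for normalised coordinates: it is 1 at
finite points and -ρ at ∞. -/
theorem exists_eq_mul_of_antiparallel {ρ : ℝ} (hρ : ρ = 1 ∨ ρ = -1) {x y : OnePoint ℂ}
    (h : (ρ : ℂ) * (lineNum x * lineDen y) + lineDen x * lineNum y = 0) :
    (∃ τ : ℂ, lineNum y = -(τ * ρ * lineNum x) ∧ lineDen y = τ * lineDen x) ∧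
      (ρ = 1 → x = lineNeg y) ∧ (ρ = -1 → x = y) := by
  induction x using OnePoint.rec with
  | infty =>
    induction y using OnePoint.rec with
    | infty =>
      refine ⟨⟨-ρ, ?_, by simp⟩, fun _ => rfl, fun _ => rfl⟩
      rcases hρ with rfl | rfl <;> simp
    | coe t =>
      rcases hρ with rfl | rfl <;> simp at h
  | coe s =>
    induction y using OnePoint.rec with
    | infty => simp at h
    | coe t =>
      simp only [lineNum_coe, lineDen_coe, one_mul, mul_one] at h ⊢
      refine ⟨⟨1, by linear_combination h, by ring⟩, fun e => ?_, fun e => ?_⟩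
      · subst e
        change _ = ((-t : ℂ) : OnePoint ℂ)
        congr 1
        push_cast at h
        linear_combination h
      · subst e
        congr 1
        push_cast at h
        linear_combination -h

theorem Joint.Parallel.exists_sign {h h' : DualQuat ℝ} {sq : h * h = -1} {sq' : h' * h' = -1}
    (hp : (Joint.R h sq).Parallel (Joint.R h' sq')) :
    ∃ ρ : ℝ, (ρ = 1 ∨ ρ = -1) ∧ h'.fst = ρ • h.fst := by
  rcases hp with hp | hp
  · exact ⟨1, Or.inl rfl, by rw [one_smul]; exact hp⟩
  · exact ⟨-1, Or.inr rfl, by rw [neg_smul, one_smul]; exact hp⟩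

theorem sub_ne_zero_of_not_sameAxis {h h' : DualQuat ℝ} {sq : h * h = -1} {sq' : h' * h' = -1}
    (hne : ¬ (Joint.R h sq).SameAxis (Joint.R h' sq')) {ρ : ℝ} (hρ : ρ = 1 ∨ ρ = -1)
    (hp : h'.fst = ρ • h.fst) : ρ • h'.snd - h.snd ≠ 0 := by
  intro h0
  have h1 := sub_eq_zero.mp h0
  apply hne
  rcases hρ with rfl | rfl
  · rw [one_smul] at hp h1
    exact Or.inl (TrivSqZeroExt.ext hp h1)
  · rw [neg_smul, one_smul] at hp h1
    exact Or.inr (TrivSqZeroExt.ext (by simpa using hp) (by simp [← h1]))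

theorem lin_mul_lin_eq_scalar {k : Type} [Field k] (θ : ℝ →+* k) {p q : ℍ[ℝ]} (hp : p * p = -1)
    (hq : q * q = -1) (h1 : q ≠ p) (h2 : q ≠ -p) {a b a' b' c : k} (hc : c ≠ 0)
    (h : lin θ p a b * lin θ q a' b' = c • (1 : ℍ[k])) : b = 0 ∧ b' = 0 := by
  rw [lin_mul_lin, ← sub_eq_zero] at h
  obtain ⟨e0, e1, e2, e3⟩ := quat_independent θ hp hq h1 h2 (α := a * a' - c) (β := -(a' * b))
    (γ := -(a * b')) (δ := b * b') (by rw [← h]; module)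
  grind

/-! ### Configurations with two parallel pairs -/

namespace Linkage

variable {L : Linkage 5}

/-- The configurations of a linkage with one P-joint and two pairs of parallel R-joints. -/
theorem config_of_parallel {i : Fin 5} {p : ℍ[ℝ]} {sq : p * p = -1} (hL : L i = Joint.P p sq)
    {h₂ h₃ h₄ h₅ : DualQuat ℝ} {sq₂ : h₂ * h₂ = -1} {sq₃ : h₃ * h₃ = -1} {sq₄ : h₄ * h₄ = -1}
    {sq₅ : h₅ * h₅ = -1} (hL₂ : L (i + 1) = Joint.R h₂ sq₂) (hL₃ : L (i + 2) = Joint.R h₃ sq₃)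
    (hL₄ : L (i + 3) = Joint.R h₄ sq₄) (hL₅ : L (i + 4) = Joint.R h₅ sq₅) {ρ ρ' : ℝ}
    (hρ : ρ = 1 ∨ ρ = -1) (hρ' : ρ' = 1 ∨ ρ' = -1) (h23 : h₃.fst = ρ • h₂.fst)
    (h45 : h₅.fst = ρ' • h₄.fst) (n24 : h₄.fst ≠ h₂.fst) (n24' : h₄.fst ≠ -h₂.fst)
    {x : Fin 5 → OnePoint ℂ} (hx : x ∈ L.configSet) :
    ((ρ = 1 → x (i + 1) = lineNeg (x (i + 2))) ∧ (ρ = -1 → x (i + 1) = x (i + 2))) ∧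
    ((ρ' = 1 → x (i + 3) = lineNeg (x (i + 4))) ∧ (ρ' = -1 → x (i + 3) = x (i + 4))) ∧
    lineNum (x (i + 1)) ^ 2 + lineDen (x (i + 1)) ^ 2 ≠ 0 ∧
    lineNum (x (i + 3)) ^ 2 + lineDen (x (i + 3)) ^ 2 ≠ 0 ∧
    ∃ s : ℂ, x i = s ∧ s • quatMap Complex.ofRealHom p =
      circ Complex.ofRealHom h₂.fst (ρ • h₃.snd - h₂.snd) (lineNum (x (i + 1)))
        (lineDen (x (i + 1))) +
      circ Complex.ofRealHom h₄.fst (ρ' • h₅.snd - h₄.snd) (lineNum (x (i + 3)))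
        (lineDen (x (i + 3))) := by
  have hpar := hx.1 i
  rw [hL] at hpar
  obtain ⟨s, hs⟩ := OnePoint.ne_infty_iff_exists.mp hpar
  have hsq : ρ ^ 2 = 1 := by rcases hρ with rfl | rfl <;> norm_num
  have hsq' : ρ' ^ 2 = 1 := by rcases hρ' with rfl | rfl <;> norm_num
  have d₂ := (dualQuat_anticomm sq₂).1
  have d₄ := (dualQuat_anticomm sq₄).1
  have hlin : ∀ (r : ℝ) (q : ℍ[ℝ]) (a b : ℂ),
      lin Complex.ofRealHom (r • q) a b = lin Complex.ofRealHom q a (r * b) := by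
    intro r q a b
    rw [lin, lin, quatMap_smul, smul_smul, mul_comm b]
    rfl
  obtain ⟨c, hc, e, -⟩ := primal_closure_of_isP (i := i) (by rw [hL]; trivial) hx
  rw [hL₂, hL₃, hL₄, hL₅] at e
  simp only [Joint.fst_motion_R] at e
  rw [h23, h45, hlin, hlin, lin_mul_self _ d₂, lin_mul_self _ d₄] at e
  -- Each pair composes to an element of the span of `1` and p₂ or p₄. As these directions are
  -- independent, a scalar product forces both factors to be scalar.
  obtain ⟨e2, e4⟩ := lin_mul_lin_eq_scalar _ d₂ d₄ n24 n24' hc e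
  have hfac : ∀ a b a' b' : ℂ, (a * a' - b * b') ^ 2 + (a * b' + b * a') ^ 2 =
      (a ^ 2 + b ^ 2) * (a' ^ 2 + b' ^ 2) := by
    intro a b a' b'
    ring
  have hN := congrArg Quaternion.normSq e
  rw [map_mul, normSq_lin_eq _ d₂, normSq_lin_eq _ d₄, Quaternion.normSq_smul, map_one,
    mul_one, hfac, hfac] at hN
  obtain ⟨⟨τ, t1, t2⟩, r1, r2⟩ := exists_eq_mul_of_antiparallel hρ
    (x := x (i + 1)) (y := x (i + 2)) (by linear_combination e2)
  obtain ⟨⟨τ', t1', t2'⟩, r1', r2'⟩ := exists_eq_mul_of_antiparallel hρ'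
    (x := x (i + 3)) (y := x (i + 4)) (by linear_combination e4)
  have hc2 : c ^ 2 ≠ 0 := pow_ne_zero 2 hc
  have N2 : lineNum (x (i + 1)) ^ 2 + lineDen (x (i + 1)) ^ 2 ≠ 0 := by
    intro h0
    apply hc2
    rw [← hN, h0, zero_mul, zero_mul]
  have N4 : lineNum (x (i + 3)) ^ 2 + lineDen (x (i + 3)) ^ 2 ≠ 0 := by
    intro h0
    apply hc2
    rw [← hN, h0, zero_mul, mul_zero]
  refine ⟨⟨r1, r2⟩, ⟨r1', r2'⟩, N2, N4, s, hs.symm, ?_⟩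
  obtain ⟨c', hc', h⟩ := closure_rotate hx
  specialize h i
  rw [hL, ← hs, hL₂, hL₃, hL₄, hL₅, motion_P_coe] at h
  simp only [motion_R_eq_dualLin] at h
  rw [mul_assoc _ (dualLin _ h₄ _ _), mul_assoc _ (dualLin _ h₂ _ _),
    dualLin_mul_dualLin _ sq₂ hsq h23 t1 t2 N2, dualLin_mul_dualLin _ sq₄ hsq' h45 t1' t2' N4] at h
  exact smul_eq_circ_add_circ hc' h

end Linkage

/-! ### The dimension bound -/

section Dimension

variable {n d : ℕ}

/-- If an immersion germ factors through two of its coordinates `(u, v)`, and these coordinates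
satisfy a nontrivial relation, then its source has dimension at most one. -/
theorem dim_le_one_of_factor {f : (Fin d → ℂ) → (Fin n → ℂ)} (hf : AnalyticAt ℂ f 0)
    (hinj : Function.Injective (fderiv ℂ f 0)) (k l : Fin n)
    (hfac : ∀ j, ∃ Φ : ℂ × ℂ → ℂ, DifferentiableAt ℂ Φ (f 0 k, f 0 l) ∧
      ∀ᶠ z in 𝓝 0, f z j = Φ (f z k, f z l))
    {Q : ℂ × ℂ → Prop} (hQ : ∀ᶠ z in 𝓝 0, Q (f z k, f z l))
    (hQ' : ¬ ∀ᶠ y in 𝓝 (f 0 k, f 0 l), Q y) : d ≤ 1 := by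
  by_contra! hd
  let π : (Fin n → ℂ) →L[ℂ] ℂ × ℂ :=
    (ContinuousLinearMap.proj k).prod (ContinuousLinearMap.proj l)
  let T : (Fin d → ℂ) → ℂ × ℂ := fun z => (f z k, f z l)
  let D := π.comp (fderiv ℂ f 0)
  have hDf := hf.hasStrictFDerivAt
  have hDT : HasStrictFDerivAt T D 0 := π.hasStrictFDerivAt.comp 0 hDf
  -- By the chain rule, the derivative of every coordinate factors through `D`, so the kernel of `D`
  -- lies in that of the immersion.
  have hker : ∀ v, D v = 0 → v = 0 := by
    intro v hv
    apply hinj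
    rw [map_zero]
    ext j
    obtain ⟨Φ, hΦ, he⟩ := hfac j
    have h1 : HasFDerivAt (fun z => f z j) ((ContinuousLinearMap.proj j).comp (fderiv ℂ f 0)) 0 :=
      ((ContinuousLinearMap.proj (R := ℂ) (φ := fun _ : Fin n => ℂ) j).hasStrictFDerivAt.comp 0
        hDf).hasFDerivAt
    have h2 : HasFDerivAt (fun z => f z j) ((fderiv ℂ Φ (T 0)).comp D) 0 :=
      (HasFDerivAt.comp (g := Φ) 0 hΦ.hasFDerivAt hDT.hasFDerivAt).congr_of_eventuallyEq he
    have h3 := congrArg (fun g => g v) (h1.unique h2)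
    simp only [ContinuousLinearMap.comp_apply, hv, map_zero] at h3
    exact h3
  have hDinj : Function.Injective (D : (Fin d → ℂ) →ₗ[ℂ] ℂ × ℂ) :=
    (injective_iff_map_eq_zero _).mpr hker
  have hle := LinearMap.finrank_le_finrank_of_injective hDinj
  simp at hle
  have hd2 : d = 2 := le_antisymm hle hd
  have hsurj : Function.Surjective (D : (Fin d → ℂ) →ₗ[ℂ] ℂ × ℂ) :=
    (LinearMap.injective_iff_surjective_of_finrank_eq_finrank (by simp [hd2])).mp hDinj
  -- A surjective strict derivative makes the map open at `0`, so the relation would hold on a full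
  -- neighbourhood.
  have hmap := hDT.map_nhds_eq_of_surj (LinearMap.range_eq_top.mpr hsurj)
  apply hQ'
  rw [show (f 0 k, f 0 l) = T 0 from rfl, ← hmap]
  exact hQ

end Dimension


/-- If a linkage with one P-joint satisfies the closure equations of two non-trivial circular
translations, then its configuration set is at most a curve. -/
theorem Linkage.ContainsManifold.le_one {L : Linkage 5} {i : Fin 5} {p p₂ p₄ d₂ d₄ : ℍ[ℝ]}
    (hp : p * p = -1) (hp₂ : p₂ * p₂ = -1) (hd₂ : d₂ ≠ 0)
    (h23 : (∀ x ∈ L.configSet, x (i + 1) = x (i + 2)) ∨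
      (∀ x ∈ L.configSet, x (i + 1) = lineNeg (x (i + 2))))
    (h45 : (∀ x ∈ L.configSet, x (i + 3) = x (i + 4)) ∨
      (∀ x ∈ L.configSet, x (i + 3) = lineNeg (x (i + 4))))
    (hK : ∀ x ∈ L.configSet, lineNum (x (i + 1)) ^ 2 + lineDen (x (i + 1)) ^ 2 ≠ 0 ∧
      lineNum (x (i + 3)) ^ 2 + lineDen (x (i + 3)) ^ 2 ≠ 0 ∧
      ∃ s : ℂ, x i = s ∧ s • quatMap Complex.ofRealHom p =
        circ Complex.ofRealHom p₂ d₂ (lineNum (x (i + 1))) (lineDen (x (i + 1))) +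
        circ Complex.ofRealHom p₄ d₄ (lineNum (x (i + 3))) (lineDen (x (i + 3))))
    {d : ℕ} (hm : L.ContainsManifold d) : d ≤ 1 := by
  obtain ⟨c, f, ⟨hf, hfK⟩, hinj⟩ := hm
  have hnorm : ∀ (c : Bool) (z : ℂ), lineNum (lineChart c z) ^ 2 + lineDen (lineChart c z) ^ 2 ≠ 0 →
      chartNum c z ^ 2 + chartDen c z ^ 2 ≠ 0 := by
    intro c z h
    obtain ⟨r, hr, e1, e2⟩ := lineNum_lineChart c z
    rw [e1, e2, mul_pow, mul_pow, ← mul_add]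
    exact mul_ne_zero (pow_ne_zero 2 hr) h
  have hcirc : ∀ (ℓ : ℍ[ℂ] →ₗ[ℂ] ℂ) (q e : ℍ[ℝ]) (c : Bool) (z : ℂ),
      ℓ (circ Complex.ofRealHom q e (lineNum (lineChart c z)) (lineDen (lineChart c z))) =
        circChart c (ℓ (quatMap Complex.ofRealHom e))
          (ℓ (quatMap Complex.ofRealHom q * quatMap Complex.ofRealHom e)) z := by
    intro ℓ q e c z
    obtain ⟨r, hr, e1, e2⟩ := lineNum_lineChart c z
    rw [← circ_mul_left _ q e hr, ← e1, ← e2, circ_apply, circChart]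
  have hK' : ∀ᶠ z in 𝓝 0,
      chartNum (c (i + 1)) (f z (i + 1)) ^ 2 + chartDen (c (i + 1)) (f z (i + 1)) ^ 2 ≠ 0 ∧
      chartNum (c (i + 3)) (f z (i + 3)) ^ 2 + chartDen (c (i + 3)) (f z (i + 3)) ^ 2 ≠ 0 ∧
      ∃ s : ℂ, lineChart (c i) (f z i) = s ∧ ∀ ℓ : ℍ[ℂ] →ₗ[ℂ] ℂ,
        s * ℓ (quatMap Complex.ofRealHom p) =
          circChart (c (i + 1)) (ℓ (quatMap Complex.ofRealHom d₂))
            (ℓ (quatMap Complex.ofRealHom p₂ * quatMap Complex.ofRealHom d₂)) (f z (i + 1)) +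
          circChart (c (i + 3)) (ℓ (quatMap Complex.ofRealHom d₄))
            (ℓ (quatMap Complex.ofRealHom p₄ * quatMap Complex.ofRealHom d₄)) (f z (i + 3)) := by
    filter_upwards [hfK] with z hz
    obtain ⟨h1, h2, s, hs, h3⟩ := hK _ hz
    refine ⟨hnorm _ _ h1, hnorm _ _ h2, s, hs, fun ℓ => ?_⟩
    have := congrArg ℓ h3
    rw [map_smul, map_add, hcirc, hcirc, smul_eq_mul] at this
    exact this
  have hpne : quatMap Complex.ofRealHom p ≠ 0 := by
    intro h0
    have := quatMap_mul_self Complex.ofRealHom hp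
    rw [h0, zero_mul] at this
    exact one_ne_zero (neg_eq_zero.mp this.symm)
  -- Applied to sp₁ = V₂ + V₄, the functional `ℓ₀` recovers s from t₂ and t₄, while `ℓ` eliminates s
  -- and leaves a relation between t₂ and t₄.
  obtain ⟨ℓ₀, hℓ₀, -⟩ := Submodule.exists_le_ker_of_notMem (K := ℂ)
    (p := (⊥ : Submodule ℂ ℍ[ℂ])) (v := quatMap Complex.ofRealHom p) (by simpa using hpne)
  obtain ⟨ℓ, hℓ, hℓ'⟩ := exists_functional Complex.ofRealHom hp₂ hd₂ (quatMap Complex.ofRealHom p)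
  have hpair : ∀ a b : Fin 5, ((∀ x ∈ L.configSet, x a = x b) ∨
      (∀ x ∈ L.configSet, x a = lineNeg (x b))) → ∃ φ : ℂ → ℂ, DifferentiableAt ℂ φ (f 0 a) ∧
        ∀ᶠ z in 𝓝 0, f z b = φ (f z a) := by
    rintro a b (h | h)
    · refine ⟨chartChange (c a) (c b), (eq_chartChange (h _ hfK.self_of_nhds)).2, ?_⟩
      filter_upwards [hfK] with z hz
      exact (eq_chartChange (h _ hz)).1
    · have h' : ∀ x ∈ L.configSet, lineNeg (x a) = x b := by
        intro x hx
        rw [h x hx]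
        generalize x b = y
        induction y using OnePoint.rec with
        | infty => rfl
        | coe t => exact congrArg ((↑) : ℂ → OnePoint ℂ) (neg_neg t)
      refine ⟨fun w => chartChange (c a) (c b) (-w), ?_, ?_⟩
      · have e := h' _ hfK.self_of_nhds
        simp only [lineNeg_lineChart] at e
        exact DifferentiableAt.comp (f 0 a) (g := chartChange (c a) (c b)) (eq_chartChange e).2
          differentiableAt_id.neg
      · filter_upwards [hfK] with z hz
        have e := h' _ hz
        simp only [lineNeg_lineChart] at e
        exact (eq_chartChange e).1
  have hfst : DifferentiableAt ℂ (Prod.fst : ℂ × ℂ → ℂ) (f 0 (i + 1), f 0 (i + 3)) :=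
    differentiableAt_fst
  have hsnd : DifferentiableAt ℂ (Prod.snd : ℂ × ℂ → ℂ) (f 0 (i + 1), f 0 (i + 3)) :=
    differentiableAt_snd
  refine dim_le_one_of_factor hf hinj (i + 1) (i + 3) ?_ (Q := fun y =>
    (chartNum (c (i + 1)) y.1 ^ 2 + chartDen (c (i + 1)) y.1 ^ 2 ≠ 0) ∧
      circChart (c (i + 1)) (ℓ (quatMap Complex.ofRealHom d₂))
        (ℓ (quatMap Complex.ofRealHom p₂ * quatMap Complex.ofRealHom d₂)) y.1 +
      circChart (c (i + 3)) (ℓ (quatMap Complex.ofRealHom d₄))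
        (ℓ (quatMap Complex.ofRealHom p₄ * quatMap Complex.ofRealHom d₄)) y.2 = 0) ?_ ?_
  · intro j
    obtain ⟨e, rfl⟩ : ∃ e, j = i + e := ⟨j - i, (add_sub_cancel i j).symm⟩
    fin_cases e
    · obtain ⟨h1, h2, s₀, hs₀, h3⟩ := hK'.self_of_nhds
      refine ⟨fun y => chartChange false (c i) ((ℓ₀ (quatMap Complex.ofRealHom p))⁻¹ *
        (circChart (c (i + 1)) (ℓ₀ (quatMap Complex.ofRealHom d₂))
            (ℓ₀ (quatMap Complex.ofRealHom p₂ * quatMap Complex.ofRealHom d₂)) y.1 +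
          circChart (c (i + 3)) (ℓ₀ (quatMap Complex.ofRealHom d₄))
            (ℓ₀ (quatMap Complex.ofRealHom p₄ * quatMap Complex.ofRealHom d₄)) y.2)), ?_, ?_⟩
      · refine DifferentiableAt.comp (g := chartChange false (c i)) _ ?_ (DifferentiableAt.const_mul
          (DifferentiableAt.add ?_ ?_) _)
        · simp only []
          rw [← h3 ℓ₀, mul_comm s₀, inv_mul_cancel_left₀ hℓ₀]
          exact (eq_chartChange (c := false) (w := s₀) (w' := f 0 i) hs₀.symm).2
        · exact DifferentiableAt.comp (g := circChart _ _ _) _ (differentiableAt_circChart _ _ _ h1)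
            hfst
        · exact DifferentiableAt.comp (g := circChart _ _ _) _ (differentiableAt_circChart _ _ _ h2)
            hsnd
      · filter_upwards [hK'] with z ⟨_, _, s, hs, h4⟩
        rw [← h4 ℓ₀, mul_comm s, inv_mul_cancel_left₀ hℓ₀]
        have := (eq_chartChange (c := false) (w := s) (w' := f z i) hs.symm).1
        simpa using this
    · exact ⟨Prod.fst, hfst, Filter.Eventually.of_forall fun z => rfl⟩
    · obtain ⟨φ, h1, h2⟩ := hpair _ _ h23
      exact ⟨fun y => φ y.1, DifferentiableAt.comp (g := φ) _ h1 hfst, h2⟩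
    · exact ⟨Prod.snd, hsnd, Filter.Eventually.of_forall fun z => rfl⟩
    · obtain ⟨φ, h1, h2⟩ := hpair _ _ h45
      exact ⟨fun y => φ y.2, DifferentiableAt.comp (g := φ) _ h1 hsnd, h2⟩
  · filter_upwards [hK'] with z ⟨h1, _, s, hs, h4⟩
    exact ⟨h1, by rw [← h4 ℓ, hℓ, mul_zero]⟩
  -- With t₄ frozen, the relation would make `ℓ` of V₂ constant in t₂.
  · intro hev
    have h1 := (Filter.Eventually.curry_nhds hev)
    have h2 : ∀ᶠ w in 𝓝 (f 0 (i + 1)), _ := h1.mono fun w hw => hw.self_of_nhds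
    have h3 := circChart_not_const (c := c (i + 1)) (A := ℓ (quatMap Complex.ofRealHom d₂))
      (B := ℓ (quatMap Complex.ofRealHom p₂ * quatMap Complex.ofRealHom d₂))
      (κ := -circChart (c (i + 3)) (ℓ (quatMap Complex.ofRealHom d₄))
        (ℓ (quatMap Complex.ofRealHom p₄ * quatMap Complex.ofRealHom d₄)) (f 0 (i + 3)))
      (h2.mono fun w hw => ⟨hw.1, eq_neg_of_add_eq_zero_left hw.2⟩)
    exact hℓ'.elim (· h3.1) (· h3.2)

/-! ### Assembling the cases -/

theorem theorem3p4 (L : Linkage 5) (hmob : L.Mobile) (hnd : ¬ L.Degenerate)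
    (hmov : ∀ k, L.Moves k) (hP : ∃ k, (L k).IsP) :
    (∀ k l, (L k).IsR → (L l).IsR → (L k).Parallel (L l)) ∨
    ∃ i : Fin 5, (∀ k, (L k).IsP ↔ k = i) ∧
      (L (i + 1)).Parallel (L (i + 2)) ∧ (L (i + 3)).Parallel (L (i + 4)) ∧
      L.mobility = 1 ∧
      ((∀ x ∈ L.configSet, x (i + 1) = x (i + 2)) ∨
        (∀ x ∈ L.configSet, x (i + 1) = lineNeg (x (i + 2)))) ∧
      ((∀ x ∈ L.configSet, x (i + 3) = x (i + 4)) ∨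
        (∀ x ∈ L.configSet, x (i + 3) = lineNeg (x (i + 4)))) := by
  obtain ⟨i, hi⟩ := hP
  by_cases htwo : ∃ j, j ≠ i ∧ (L j).IsP
  · obtain ⟨j, hji, hj⟩ := htwo
    exact Or.inl fun k l hk hl => Linkage.parallel_of_two_isP hmov hji hj hi hk hl
  have hR : ∀ j, j ≠ i → (L j).IsR := fun j hj =>
    Joint.isR_of_not_isP fun h => htwo ⟨j, hj, h⟩
  have hne : ∀ j : Fin 5, j + 1 ≠ j ∧ j + 2 ≠ j ∧ j + 3 ≠ j ∧ j + 4 ≠ j := by decide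
  have r₂ := hR _ (hne i).1
  have r₃ := hR _ (hne i).2.1
  have r₄ := hR _ (hne i).2.2.1
  have r₅ := hR _ (hne i).2.2.2
  obtain ⟨h23, h45⟩ := Linkage.parallel_and_parallel hi r₂ r₃ r₄ r₅ hmov
  by_cases h24 : (L (i + 1)).Parallel (L (i + 3))
  · left
    have hall : ∀ k, (L k).IsR → (L (i + 1)).Parallel (L k) := by
      intro k hk
      obtain ⟨e, rfl⟩ : ∃ e, k = i + e := ⟨k - i, (add_sub_cancel i k).symm⟩
      fin_cases e
      · exact (Joint.not_isP_of_isR hk (by simpa using hi)).elim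
      · exact Joint.Parallel.refl _
      · exact h23
      · exact h24
      · exact h24.trans h45
    exact fun k l hk hl => (hall k hk).symm.trans (hall l hl)
  right
  have hone : ∀ k, (L k).IsP ↔ k = i := fun k =>
    ⟨fun hk => by_contra fun hki => htwo ⟨k, hki, hk⟩, fun hk => hk ▸ hi⟩
  obtain ⟨p, sq, hL⟩ := hi.exists_eq
  obtain ⟨a₂, sq₂, hL₂⟩ := r₂.exists_eq
  obtain ⟨a₃, sq₃, hL₃⟩ := r₃.exists_eq
  obtain ⟨a₄, sq₄, hL₄⟩ := r₄.exists_eq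
  obtain ⟨a₅, sq₅, hL₅⟩ := r₅.exists_eq
  have p23 := h23
  have p45 := h45
  rw [hL₂, hL₃] at p23
  rw [hL₄, hL₅] at p45
  obtain ⟨ρ, hρ, e23⟩ := p23.exists_sign
  obtain ⟨ρ', hρ', e45⟩ := p45.exists_sign
  rw [hL₂, hL₄] at h24
  simp only [Joint.Parallel, Joint.dir, not_or] at h24
  have hconf := fun x (hx : x ∈ L.configSet) => Linkage.config_of_parallel hL hL₂ hL₃ hL₄ hL₅ hρ hρ'
    e23 e45 h24.1 h24.2 hx
  have s23 : (∀ x ∈ L.configSet, x (i + 1) = x (i + 2)) ∨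
      (∀ x ∈ L.configSet, x (i + 1) = lineNeg (x (i + 2))) :=
    hρ.symm.imp (fun h x hx => (hconf x hx).1.2 h) fun h x hx => (hconf x hx).1.1 h
  have s45 : (∀ x ∈ L.configSet, x (i + 3) = x (i + 4)) ∨
      (∀ x ∈ L.configSet, x (i + 3) = lineNeg (x (i + 4))) :=
    hρ'.symm.imp (fun h x hx => (hconf x hx).2.1.2 h) fun h x hx => (hconf x hx).2.1.1 h
  -- Non-degeneracy enters here: parallel but distinct axes give a circular translation that is not
  -- trivial.
  have hd : ρ • a₃.snd - a₂.snd ≠ 0 := by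
    refine sub_ne_zero_of_not_sameAxis (sq := sq₂) (sq' := sq₃) (fun h => hnd ⟨i + 1, Or.inl ?_⟩)
      hρ e23
    rw [show i + 1 + 1 = i + 2 by rw [add_assoc]; rfl, hL₂, hL₃]
    exact h
  refine ⟨i, hone, h23, h45, le_antisymm (iSup₂_le fun d hm => ?_) ?_, s23, s45⟩
  · exact_mod_cast Linkage.ContainsManifold.le_one sq (dualQuat_anticomm sq₂).1 hd s23 s45
      (fun x hx => (hconf x hx).2.2) hm
  · exact Order.one_le_iff_pos.mpr hmob

end
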